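/- Let $K$ be a field of characteristic zero and let $D$ be a set. A \emph{partitioned tree decorated by $D$} is a finite nonempty rooted forest together with a partition of its vertices and a map from its vertices to $D$, such that two vertices lying in the same part are either both roots or have the same parent, and such that all the roots lie in the same part. Let $PT(D)$ be the set of isomorphism classes of partitioned trees decorated by $D$, and let $\mathfrak g_{PT(D)}$ be the $K$-vector space with basis $PT(D)$, with the following bilinear products, for $t,t'\in PT(D)$: - $t\bullet t'=\sum_{s} t\bullet_s t'$, the sum being over all the vertices $s$ of $t$, where $t\bullet_s t'$ is obtained by grafting all the roots of $t'$ on the vertex $s$ of $t$, its set of parts being the disjoint union of the sets of parts of $t$ and of $t'$; - $t \sqcup\!\!\sqcup t'$ is the disjoint union of $t$ and $t'$, its parts being those of $t$ and of $t'$, except that the part of the roots of $t$ and the part of the roots of $t'$ are merged into one. Let $\delta:\mathfrak g_{PT(D)}\to\mathfrak g_{PT(D)}\otimes\mathfrak g_{PT(D)}$ be the linear map defined on a partitioned tree $t$ with $k$ roots by $$\delta(t)=\frac1k\sum_{J} (t/J)\otimes t_J,$$ where $J$ runs over the parts of $t$ whose elements have a root of $t$ as their parent, $t_J$ is the partitioned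 tree formed by the elements of $J$ and all the vertices above them, and $t/J$ is what remains of $t$ when $t_J$ is cut off. Then: 1. $(\mathfrak g_{PT(D)},\bullet,\sqcup\!\!\sqcup )$ is a Com-Prelie algebra: for all $x,y,z$, $(x\bullet y)\bullet z-x\bullet(y\bullet z)=(x\bullet z)\bullet y-x\bullet(z\bullet y)$, the product $\sqcup\!\!\sqcup $ is associative and commutative, and $(x\sqcup\!\!\sqcup y)\bullet z=(x\bullet z)\sqcup\!\!\sqcup y+x\sqcup\!\!\sqcup (y\bullet z)$. 2. For all $x$, $(\delta\otimes \mathrm{Id})\circ\delta(x)$ is invariant under the exchange of the second and third tensor factors; for all $x,y$, $\delta(x\bullet y)=x\otimes y+\delta(x)\bullet y$, where $(a\otimes b)\bullet y=(a\bullet y)\otimes b+a\otimes(b\bullet y)$. 3. The prelie algebra $(\mathfrak g_{PT(D)},\bullet)$ is freely generated by $\mathrm{Ker}(\delta)$: for every (right) prelie algebra $A$ over $K$ and every linear map $f:\mathrm{Ker}(\delta)\to A$, there is a unique morphism of prelie algebras $\varphi:\mathfrak g_{PT(D)}\to A$ which extends $f$. -/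

import Mathlib

open scoped TensorProduct

universe u v w

noncomputable section

/-- A partitioned forest with vertex set `V`, decorated by `D`. The rooted forest is given by its
`parent` map (`none` at a root; otherwise the direct descendant, edges being oriented from the
leaves to the roots), which has no infinite descending path. Two vertices in the same part are
both roots or have the same direct descendant, that is to say have the same value of `parent`. -/
structure PForest (D : Type u) (V : Type v) where
  parent : V → Option V
  wf : WellFounded fun x y => parent y = some x
  part : Setoid V
  parent_eq : ∀ {x y}, part.r x y → parent x = parent y
  deco : V → D

namespace PForest

variable {D : Type u} {V V' W W' : Type*}

/-- A partitioned forest is a partitioned tree if it is nonempty and all its roots are in the same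
part. -/
structure IsTree (F : PForest D V) : Prop where
  nonempty : Nonempty V
  roots : ∀ x y, F.parent x = none → F.parent y = none → F.part.r x y

/-- Isomorphisms of decorated partitioned forests. -/
structure Iso (F : PForest D V) (G : PForest D W) where
  e : V ≃ W
  map_parent : ∀ x, G.parent (e x) = (F.parent x).map e
  map_part : ∀ x y, G.part.r (e x) (e y) ↔ F.part.r x y
  map_deco : ∀ x, G.deco (e x) = F.deco x

namespace Iso

def refl (F : PForest D V) : F.Iso F where
  e := Equiv.refl V
  map_parent x := by simp
  map_part x y := Iff.rfl
  map_deco x := rfl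

def symm {F : PForest D V} {G : PForest D W} (i : F.Iso G) : G.Iso F where
  e := i.e.symm
  map_parent x := by
    have h := i.map_parent (i.e.symm x)
    rw [Equiv.apply_symm_apply] at h
    rw [h, Option.map_map]
    simp
  map_part x y := by
    have h := i.map_part (i.e.symm x) (i.e.symm y)
    simpa using h.symm
  map_deco x := by
    have h := i.map_deco (i.e.symm x)
    simpa using h.symm

def trans {V₁ V₂ V₃ : Type*} {F : PForest D V₁} {G : PForest D V₂} {H : PForest D V₃}
    (i : F.Iso G) (j : G.Iso H) : F.Iso H where
  e := i.e.trans j.e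
  map_parent x := by
    simp only [Equiv.trans_apply, j.map_parent, i.map_parent, Option.map_map]
    rfl
  map_part x y := by simp [j.map_part, i.map_part]
  map_deco x := by simp [j.map_deco, i.map_deco]

theorem isTree {F : PForest D V} {G : PForest D W} (i : F.Iso G) (h : F.IsTree) : G.IsTree where
  nonempty := h.nonempty.map i.e
  roots x y hx hy := by
    have h1 := i.symm.map_parent x
    have h2 := i.symm.map_parent y
    rw [hx] at h1
    rw [hy] at h2
    exact (i.symm.map_part x y).1 (h.roots _ _ h1 h2)

end Iso

/-- Transport of a partitioned forest along a bijection of the vertices. -/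
def map (F : PForest D V) (e : V ≃ W) : PForest D W where
  parent x := (F.parent (e.symm x)).map e
  wf := by
    refine Subrelation.wf ?_ (InvImage.wf e.symm F.wf)
    intro x y h
    obtain ⟨a, ha, rfl⟩ := Option.map_eq_some_iff.1 h
    simpa [InvImage] using ha
  part := F.part.comap e.symm
  parent_eq h := by rw [F.parent_eq h]
  deco x := F.deco (e.symm x)

def mapIso (F : PForest D V) (e : V ≃ W) : F.Iso (F.map e) where
  e := e
  map_parent x := by simp [map]
  map_part x y := by
    change F.part.r (e.symm (e x)) (e.symm (e y)) ↔ _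
    simp
  map_deco x := by simp [map]

/-- `F.graft s G` is obtained by grafting all the roots of `G` on the vertex `s` of `F`. Its set of
parts is the disjoint union of the sets of parts of `F` and of `G`. -/
def graft (F : PForest D V) (s : V) (G : PForest D W) : PForest D (V ⊕ W) where
  parent := Sum.elim (fun a => (F.parent a).map Sum.inl)
    fun b => some ((G.parent b).elim (Sum.inl s) Sum.inr)
  wf := by
    have h1 : ∀ a, Acc (fun x y : V ⊕ W => Sum.elim (fun a => (F.parent a).map Sum.inl)
        (fun b => some ((G.parent b).elim (Sum.inl s) Sum.inr)) y = some x) (Sum.inl a) := by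
      intro a
      induction a using F.wf.induction with
      | _ a ih =>
        refine Acc.intro _ fun x hx => ?_
        obtain ⟨c, hc, rfl⟩ := Option.map_eq_some_iff.1 hx
        exact ih c hc
    refine ⟨fun x => ?_⟩
    rcases x with a | b
    · exact h1 a
    · induction b using G.wf.induction with
      | _ b ih =>
        refine Acc.intro _ fun x hx => ?_
        rcases hb : G.parent b with _ | c
        · simp only [Sum.elim_inr, hb, Option.elim_none, Option.some.injEq] at hx
          exact hx ▸ h1 s
        · simp only [Sum.elim_inr, hb, Option.elim_some, Option.some.injEq] at hx
          exact hx ▸ ih c hb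
  part :=
    { r := Sum.LiftRel F.part.r G.part.r
      iseqv :=
        { refl := by
            rintro (a | b)
            · exact .inl (F.part.refl a)
            · exact .inr (G.part.refl b)
          symm := by
            rintro _ _ (h | h)
            · exact .inl (F.part.symm h)
            · exact .inr (G.part.symm h)
          trans := by
            rintro _ _ _ (h | h) (h' | h')
            · exact .inl (F.part.trans h h')
            · exact .inr (G.part.trans h h') } }
  parent_eq := by
    rintro _ _ (h | h)
    · simp [F.parent_eq h]
    · simp [G.parent_eq h]
  deco := Sum.elim F.deco G.deco

theorem IsTree.graft {F : PForest D V} (hF : F.IsTree) (s : V) (G : PForest D W) :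
    (F.graft s G).IsTree where
  nonempty := ⟨Sum.inl s⟩
  roots := by
    rintro (a | b) (a' | b') h h'
    · exact .inl (hF.roots _ _ (by simpa [PForest.graft] using h)
        (by simpa [PForest.graft] using h'))
    · simp [PForest.graft] at h'
    · simp [PForest.graft] at h
    · simp [PForest.graft] at h

def Iso.graft {F : PForest D V} {F' : PForest D V'} {G : PForest D W} {G' : PForest D W'}
    (i : F.Iso F') (s : V) (j : G.Iso G') : (F.graft s G).Iso (F'.graft (i.e s) G') where
  e := i.e.sumCongr j.e
  map_parent := by
    rintro (a | b)
    · simp only [PForest.graft, Equiv.sumCongr_apply, Sum.map_inl, Sum.elim_inl, i.map_parent,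
        Option.map_map]
      rfl
    · simp only [PForest.graft, Equiv.sumCongr_apply, Sum.map_inr, Sum.elim_inr, j.map_parent]
      cases G.parent b <;> simp
  map_part := by
    intro x y
    change Sum.LiftRel F'.part.r G'.part.r _ _ ↔ Sum.LiftRel F.part.r G.part.r _ _
    rcases x with a | b <;> rcases y with a' | b' <;>
      simp only [Equiv.sumCongr_apply, Sum.map_inl, Sum.map_inr, Sum.liftRel_inl_inl,
        Sum.liftRel_inr_inr, Sum.not_liftRel_inl_inr, Sum.not_liftRel_inr_inl, i.map_part,
        j.map_part]
  map_deco := by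
    rintro (a | b) <;> simp [PForest.graft, i.map_deco, j.map_deco]

/-- The forest underlying `F.join G` is the disjoint union of `F` and `G`. The parts are those of
`F` and of `G`, except that all the roots are gathered in a single part. -/
def join (F : PForest D V) (G : PForest D W) : PForest D (V ⊕ W) where
  parent := Sum.elim (fun a => (F.parent a).map Sum.inl) fun b => (G.parent b).map Sum.inr
  wf := by
    refine ⟨fun x => ?_⟩
    rcases x with a | b
    · induction a using F.wf.induction with
      | _ a ih =>
        refine Acc.intro _ fun x hx => ?_
        obtain ⟨c, hc, rfl⟩ := Option.map_eq_some_iff.1 hx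
        exact ih c hc
    · induction b using G.wf.induction with
      | _ b ih =>
        refine Acc.intro _ fun x hx => ?_
        obtain ⟨c, hc, rfl⟩ := Option.map_eq_some_iff.1 hx
        exact ih c hc
  part :=
    { r := fun x y => Sum.LiftRel F.part.r G.part.r x y ∨
        (Sum.elim (fun a => F.parent a = none) (fun b => G.parent b = none) x ∧
          Sum.elim (fun a => F.parent a = none) (fun b => G.parent b = none) y)
      iseqv :=
        { refl := by
            rintro (a | b)
            · exact .inl (.inl (F.part.refl a))
            · exact .inl (.inr (G.part.refl b))
          symm := by
            rintro _ _ ((h | h) | ⟨h, h'⟩)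
            · exact .inl (.inl (F.part.symm h))
            · exact .inl (.inr (G.part.symm h))
            · exact .inr ⟨h', h⟩
          trans := by
            rintro x y z (h | ⟨h, h'⟩) (k | ⟨k, k'⟩)
            · rcases h with h | h <;> rcases k with k | k
              · exact .inl (.inl (F.part.trans h k))
              · exact .inl (.inr (G.part.trans h k))
            · refine .inr ⟨?_, k'⟩
              rcases h with h | h
              · exact (F.parent_eq h).trans k
              · exact (G.parent_eq h).trans k
            · refine .inr ⟨h, ?_⟩
              rcases k with k | k
              · exact (F.parent_eq k).symm.trans h'
              · exact (G.parent_eq k).symm.trans h'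
            · exact .inr ⟨h, k'⟩ } }
  parent_eq := by
    rintro x y ((h | h) | ⟨h, h'⟩)
    · simp [F.parent_eq h]
    · simp [G.parent_eq h]
    · rcases x with a | b <;> rcases y with a' | b' <;> simp_all
  deco := Sum.elim F.deco G.deco

theorem IsTree.join {F : PForest D V} (hF : F.IsTree) (G : PForest D W) :
    (F.join G).IsTree where
  nonempty := hF.nonempty.map Sum.inl
  roots := by
    rintro x y h h'
    refine Or.inr ⟨?_, ?_⟩
    · rcases x with a | b <;> simpa [PForest.join] using h
    · rcases y with a | b <;> simpa [PForest.join] using h'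

def Iso.join {F : PForest D V} {F' : PForest D V'} {G : PForest D W} {G' : PForest D W'}
    (i : F.Iso F') (j : G.Iso G') : (F.join G).Iso (F'.join G') where
  e := i.e.sumCongr j.e
  map_parent := by
    rintro (a | b)
    · simp only [PForest.join, Equiv.sumCongr_apply, Sum.map_inl, Sum.elim_inl, i.map_parent,
        Option.map_map]
      rfl
    · simp only [PForest.join, Equiv.sumCongr_apply, Sum.map_inr, Sum.elim_inr, j.map_parent,
        Option.map_map]
      rfl
  map_part := by
    intro x y
    change (Sum.LiftRel F'.part.r G'.part.r _ _ ∨ _) ↔ (Sum.LiftRel F.part.r G.part.r _ _ ∨ _)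
    rcases x with a | b <;> rcases y with a' | b' <;>
      simp only [Equiv.sumCongr_apply, Sum.map_inl, Sum.map_inr, Sum.liftRel_inl_inl,
        Sum.liftRel_inr_inr, Sum.not_liftRel_inl_inr, Sum.not_liftRel_inr_inl, i.map_part,
        j.map_part, Sum.elim_inl, Sum.elim_inr, i.map_parent, j.map_parent,
        Option.map_eq_none_iff]
  map_deco := by
    rintro (a | b) <;> simp [PForest.join, i.map_deco, j.map_deco]

open Classical in
/-- The partitioned forest induced on a set `S` of vertices. -/
def restrict (F : PForest D V) (S : Set V) : PForest D S where
  parent x := (F.parent x).bind fun y => if h : y ∈ S then some ⟨y, h⟩ else none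
  wf := by
    refine Subrelation.wf ?_ (InvImage.wf Subtype.val F.wf)
    intro x y h
    obtain ⟨a, ha, h⟩ := Option.bind_eq_some_iff.1 h
    split_ifs at h with h'
    simp only [Option.some.injEq] at h
    subst h
    exact ha
  part := F.part.comap Subtype.val
  parent_eq h := by rw [F.parent_eq h]
  deco x := F.deco x

def Iso.restrict {F : PForest D V} {G : PForest D W} (i : F.Iso G) (S : Set V) (T : Set W)
    (h : ∀ x, i.e x ∈ T ↔ x ∈ S) : (F.restrict S).Iso (G.restrict T) where
  e := i.e.subtypeEquiv fun x => (h x).symm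
  map_parent := by
    rintro ⟨x, hx⟩
    simp only [PForest.restrict, Equiv.subtypeEquiv_apply, i.map_parent]
    rcases F.parent x with _ | y
    · rfl
    · by_cases hy : y ∈ S
      · simp [hy, h]
      · simp [hy, h]
  map_part x y := i.map_part x y
  map_deco x := i.map_deco x

/-- The parts whose elements are the direct ascendants of some root. -/
def IsFirstPart (F : PForest D V) (J : Quotient F.part) : Prop :=
  ∃ x r, Quotient.mk F.part x = J ∧ F.parent x = some r ∧ F.parent r = none

/-- The vertices of the branch born from the part `J`: those from which a vertex of `J` is reached
by going down towards the roots (in zero or more steps). -/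
def branchSet (F : PForest D V) (J : Quotient F.part) : Set V :=
  {x | ∃ y, Quotient.mk F.part y = J ∧ Relation.ReflTransGen (fun a b => F.parent a = some b) x y}

/-- The partitioned tree born from the part `J`. -/
def branch (F : PForest D V) (J : Quotient F.part) : PForest D (F.branchSet J) :=
  F.restrict _

/-- What remains of `F` when the branch born from the part `J` is cut off. -/
def trunk (F : PForest D V) (J : Quotient F.part) : PForest D ((F.branchSet J)ᶜ : Set V) :=
  F.restrict _

theorem notMem_branchSet_of_root (F : PForest D V) {J : Quotient F.part} (hJ : F.IsFirstPart J)
    {r : V} (hr : F.parent r = none) : r ∉ F.branchSet J := by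
  rintro ⟨y, hy, h⟩
  obtain ⟨x, s, hx, hxs, -⟩ := hJ
  rcases h.cases_head with rfl | ⟨c, hc, -⟩
  · have := F.parent_eq (Quotient.exact (hx.trans hy.symm))
    simp [hxs, hr] at this
  · simp [hr] at hc

theorem IsTree.branch {F : PForest D V} (J : Quotient F.part) :
    (F.branch J).IsTree where
  nonempty := by
    obtain ⟨y, hy⟩ := Quotient.exists_rep J
    exact ⟨⟨y, y, hy, .refl⟩⟩
  roots := by
    have key : ∀ x : F.branchSet J, (F.branch J).parent x = none →
        Quotient.mk F.part x.1 = J := by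
      rintro ⟨x, y, hy, h⟩ hx
      rcases h.cases_head with rfl | ⟨c, hc, hcy⟩
      · exact hy
      · have : c ∈ F.branchSet J := ⟨y, hy, hcy⟩
        simp [PForest.branch, PForest.restrict, hc, this] at hx
    intro x y hx hy
    exact Quotient.exact (s := F.part) ((key x hx).trans (key y hy).symm)

theorem IsTree.trunk {F : PForest D V} (hF : F.IsTree) {J : Quotient F.part}
    (hJ : F.IsFirstPart J) : (F.trunk J).IsTree where
  nonempty := by
    obtain ⟨x, r, hx, hxr, hr⟩ := hJ
    exact ⟨⟨r, F.notMem_branchSet_of_root ⟨x, r, hx, hxr, hr⟩ hr⟩⟩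
  roots := by
    have key : ∀ x : ((F.branchSet J)ᶜ : Set V), (F.trunk J).parent x = none →
        F.parent x.1 = none := by
      rintro ⟨x, hx⟩ h
      rcases hp : F.parent x with _ | c
      · rfl
      · have : c ∉ F.branchSet J := by
          rintro ⟨y, hy, hcy⟩
          exact hx ⟨y, hy, .head hp hcy⟩
        simp [PForest.trunk, PForest.restrict, hp, this] at h
    intro x y hx hy
    exact hF.roots _ _ (key x hx) (key y hy)

/-- The bijection between the parts induced by an isomorphism. -/
def Iso.parts {F : PForest D V} {G : PForest D W} (i : F.Iso G) :
    Quotient F.part ≃ Quotient G.part :=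
  Quotient.congr i.e fun x y => (i.map_part x y).symm

theorem Iso.isFirstPart {F : PForest D V} {G : PForest D W} (i : F.Iso G) (J : Quotient F.part)
    (h : F.IsFirstPart J) : G.IsFirstPart (i.parts J) := by
  obtain ⟨x, r, rfl, hx, hr⟩ := h
  exact ⟨i.e x, i.e r, rfl, by rw [i.map_parent, hx]; rfl, by rw [i.map_parent, hr]; rfl⟩

theorem Iso.mem_branchSet {F : PForest D V} {G : PForest D W} (i : F.Iso G)
    (J : Quotient F.part) (x : V) (h : x ∈ F.branchSet J) :
    i.e x ∈ G.branchSet (i.parts J) := by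
  obtain ⟨y, rfl, h⟩ := h
  refine ⟨i.e y, rfl, h.lift i.e fun a b hab => ?_⟩
  change G.parent (i.e a) = some (i.e b)
  rw [i.map_parent, hab]
  rfl

theorem Iso.mem_branchSet_iff {F : PForest D V} {G : PForest D W} (i : F.Iso G)
    (J : Quotient F.part) (x : V) :
    i.e x ∈ G.branchSet (i.parts J) ↔ x ∈ F.branchSet J := by
  refine ⟨fun h => ?_, i.mem_branchSet J x⟩
  have := i.symm.mem_branchSet _ _ h
  have e1 : i.symm.e (i.e x) = x := i.e.symm_apply_apply x
  have e2 : i.symm.parts (i.parts J) = J := i.parts.symm_apply_apply J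
  rwa [e1, e2] at this

def Iso.branch {F : PForest D V} {G : PForest D W} (i : F.Iso G) (J : Quotient F.part) :
    (F.branch J).Iso (G.branch (i.parts J)) :=
  i.restrict _ _ (i.mem_branchSet_iff J)

def Iso.trunk {F : PForest D V} {G : PForest D W} (i : F.Iso G) (J : Quotient F.part) :
    (F.trunk J).Iso (G.trunk (i.parts J)) :=
  i.restrict _ _ fun x => not_congr (i.mem_branchSet_iff J x)

/-- The number of roots. -/
def numRoots (F : PForest D V) : ℕ := Nat.card {x // F.parent x = none}

theorem Iso.numRoots {F : PForest D V} {G : PForest D W} (i : F.Iso G) :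
    F.numRoots = G.numRoots :=
  Nat.card_congr (i.e.subtypeEquiv fun x => by simp [i.map_parent])

end PForest

/-- Finite decorated partitioned trees, with vertices numbered from `0` to `n - 1`. -/
structure FinPTree (D : Type u) where
  n : ℕ
  forest : PForest D (Fin n)
  isTree : forest.IsTree

instance FinPTree.setoid (D : Type u) : Setoid (FinPTree D) where
  r s t := Nonempty (s.forest.Iso t.forest)
  iseqv :=
    { refl := fun s => ⟨.refl s.forest⟩
      symm := fun ⟨i⟩ => ⟨i.symm⟩
      trans := fun ⟨i⟩ ⟨j⟩ => ⟨i.trans j⟩ }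

/-- The set of isomorphism classes of finite partitioned trees decorated by `D`. -/
def PT (D : Type u) : Type u := Quotient (FinPTree.setoid D)

namespace PT

variable {D : Type u} {V W : Type*}

/-- The isomorphism class of a partitioned tree with any finite set of vertices. -/
def mk [Finite V] (F : PForest D V) (hF : F.IsTree) : PT D :=
  Quotient.mk _ ⟨Nat.card V, F.map (Finite.equivFin V), (F.mapIso _).isTree hF⟩

theorem mk_eq_mk_iff [Finite V] [Finite W] {F : PForest D V} {G : PForest D W} {hF : F.IsTree}
    {hG : G.IsTree} : mk F hF = mk G hG ↔ Nonempty (F.Iso G) := by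
  constructor
  · intro h
    obtain ⟨i⟩ := Quotient.exact h
    exact ⟨((F.mapIso _).trans i).trans (G.mapIso _).symm⟩
  · rintro ⟨i⟩
    exact Quotient.sound ⟨((F.mapIso _).symm.trans i).trans (G.mapIso _)⟩

end PT

/-- The vector space `𝔤_{PT(D)}` with basis the decorated partitioned trees. -/
abbrev GPT (K : Type v) [Field K] (D : Type u) : Type (max u v) := PT D →₀ K

namespace GPT

variable (K : Type v) [Field K] (D : Type u)

/-- `t • t' = ∑ t •ₛ t'`, the sum being over the vertices `s` of `t`. -/
def graftSum : PT D → PT D → GPT K D :=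
  Quotient.lift₂
    (fun t t' => ∑ s : Fin t.n,
      Finsupp.single (PT.mk (t.forest.graft s t'.forest) (t.isTree.graft s _)) 1)
    (by
      rintro t₁ t₁' t₂ t₂' ⟨i⟩ ⟨j⟩
      refine Fintype.sum_equiv i.e _ _ fun s => ?_
      rw [PT.mk_eq_mk_iff.2 ⟨i.graft s j⟩])

/-- The pre-Lie product `•` of `𝔤_{PT(D)}`. -/
def bullet : GPT K D →ₗ[K] GPT K D →ₗ[K] GPT K D :=
  Finsupp.linearCombination K fun t => Finsupp.linearCombination K fun t' => graftSum K D t t'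

/-- The product `ш` of two decorated partitioned trees. -/
def join : PT D → PT D → PT D :=
  Quotient.lift₂ (fun t t' => PT.mk (t.forest.join t'.forest) (t.isTree.join _))
    (by
      rintro t₁ t₁' t₂ t₂' ⟨i⟩ ⟨j⟩
      exact PT.mk_eq_mk_iff.2 ⟨i.join j⟩)

/-- The commutative product `ш` of `𝔤_{PT(D)}`. -/
def shuffle : GPT K D →ₗ[K] GPT K D →ₗ[K] GPT K D :=
  Finsupp.linearCombination K fun t => Finsupp.linearCombination K fun t' =>
    Finsupp.single (join D t t') 1

open Classical in
/-- `δ(t) = (1/k) ∑ (t / J) ⊗ J` where `k` is the number of roots of `t` and `J` runs over the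
partitioned trees born from the roots of `t`, `t / J` being obtained by cutting off `J`. -/
def cutSum : PT D → GPT K D ⊗[K] GPT K D :=
  Quotient.lift
    (fun t => (t.forest.numRoots : K)⁻¹ • ∑ J : {J // t.forest.IsFirstPart J},
      Finsupp.single (PT.mk (t.forest.trunk J.1) (t.isTree.trunk J.2)) (1 : K) ⊗ₜ[K]
        Finsupp.single (PT.mk (t.forest.branch J.1) (.branch J.1)) (1 : K))
    (by
      rintro t t' ⟨i⟩
      rw [i.numRoots]
      congr 1
      refine Fintype.sum_equiv (i.parts.subtypeEquiv fun J => ⟨i.isFirstPart J, fun h => ?_⟩) _ _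
        fun J => ?_
      · have := i.symm.isFirstPart _ h
        rwa [show i.symm.parts (i.parts J) = J from i.parts.symm_apply_apply J] at this
      · have h1 := PT.mk_eq_mk_iff (hF := t.isTree.trunk J.2)
          (hG := t'.isTree.trunk (i.isFirstPart _ J.2)) |>.2 ⟨i.trunk J.1⟩
        have h2 := PT.mk_eq_mk_iff (hF := .branch J.1) (hG := .branch _) |>.2 ⟨i.branch J.1⟩
        rw [h1, h2]
        rfl)

/-- The coproduct `δ` of `𝔤_{PT(D)}`. -/
def delta : GPT K D →ₗ[K] GPT K D ⊗[K] GPT K D :=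
  Finsupp.linearCombination K (cutSum K D)

end GPT

/-- The axioms of Com-Prelie algebras, for a (right) pre-Lie product `m` and a commutative
product `c`. -/
structure IsComPreLie {K : Type v} [Field K] {L : Type w} [AddCommGroup L] [Module K L]
    (m c : L →ₗ[K] L →ₗ[K] L) : Prop where
  preLie : ∀ x y z, m (m x y) z - m x (m y z) = m (m x z) y - m x (m z y)
  comm : ∀ x y, c x y = c y x
  assoc : ∀ x y z, c (c x y) z = c x (c y z)
  leibniz : ∀ x y z, m (c x y) z = c (m x z) y + c x (m y z)

end

/-! Assertions 1 and 2 are combinatorial: each identity matches the terms of two sums through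
isomorphisms of forests. The associator of `t, t', t''` is the sum of the ways to graft `t'` and
`t''` independently on vertices of `t`, hence is symmetric in `t', t''`. A cut of `t •ₛ t'` either
detaches `t'`, which is possible exactly when `s` is one of the `k` roots and so gives `t ⊗ t'`
after division by `k`, or detaches a branch of `t`, with `t'` sitting on the trunk or on the branch
according to `s`. Two successive cuts commute, and a cut leaves `k` unchanged.

Assertion 3 holds for every pre-Lie algebra with such a coproduct and a connected filtration, in
characteristic zero. The tool is `E = • ∘ δ` (`euler`). On the left coradical filtration (`corad`),
whose first term is `ker δ`, the symmetry of `(δ ⊗ id) ∘ δ` makes `E` triangular: `E - n` sends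
`corad δ (n + 1)` into `corad δ n` (`euler_sub_mem`). Dividing by nonzero eigenvalues gives two
facts. Products lie in the range of `E`, and `E ∘ E` and `E` have the same kernel, so `ker δ`
contains no nonzero sum of products (`eq_zero_of_mem_ker`). Moreover, a subspace containing `ker δ`
and stable under `•` and `δ` is everything (`mem_of_ker_le`).

The free pre-Lie algebra has a coproduct of the same kind that vanishes on generators; by the first
fact its kernel is spanned by them. The morphism from the free algebra on a basis of `ker δ`
commutes with the coproducts. It is injective on generators, hence everywhere by induction on the
degree, and it is surjective by the second fact. -/

namespace PreLieRigidity

/-! ### The Euler operator of a pre-Lie algebra with a compatible coproduct. -/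

open TensorProduct

variable {K : Type*} [Field K] {L : Type*} [AddCommGroup L] [Module K L]

/-- The right action of `y` on `L ⊗ L` by derivation. -/
def act (m : L →ₗ[K] L →ₗ[K] L) (y : L) : L ⊗[K] L →ₗ[K] L ⊗[K] L :=
  (m.flip y).rTensor L + (m.flip y).lTensor L

theorem act_tmul (m : L →ₗ[K] L →ₗ[K] L) (y a b : L) :
    act m y (a ⊗ₜ b) = m a y ⊗ₜ b + a ⊗ₜ m b y := rfl

/-- A right pre-Lie product `m` together with a compatible NAP coproduct `δ`. -/
structure IsBialgebra (m : L →ₗ[K] L →ₗ[K] L) (δ : L →ₗ[K] L ⊗[K] L) : Prop where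
  preLie : ∀ x y z, m (m x y) z - m x (m y z) = m (m x z) y - m x (m z y)
  perm : ∀ x, δ.rTensor L (δ x) = TensorProduct.rightComm K L L L (δ.rTensor L (δ x))
  compat : ∀ x y, δ (m x y) = x ⊗ₜ y + act m y (δ x)

/-- An exhaustive filtration which the coproduct strictly decreases. -/
structure IsConnectedFiltration (δ : L →ₗ[K] L ⊗[K] L) (H : ℕ → Submodule K L) : Prop where
  zero : H 0 = ⊥
  succ : ∀ n, ∀ x ∈ H (n + 1), δ x ∈ Submodule.map₂ (TensorProduct.mk K L L) (H n) (H n)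
  exhaust : ∀ x, ∃ n, x ∈ H n

/-- The left coradical filtration of `δ`. -/
def corad (δ : L →ₗ[K] L ⊗[K] L) : ℕ → Submodule K L
  | 0 => ⊥
  | n + 1 => (Submodule.map₂ (TensorProduct.mk K L L) (corad δ n) ⊤).comap δ

theorem mem_corad_succ {δ : L →ₗ[K] L ⊗[K] L} {n : ℕ} {x : L} :
    x ∈ corad δ (n + 1) ↔ δ x ∈ Submodule.map₂ (TensorProduct.mk K L L) (corad δ n) ⊤ :=
  Iff.rfl

theorem map_mem_of_mem_map₂ {M N P : Type*} [AddCommGroup M] [Module K M] [AddCommGroup N]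
    [Module K N] [AddCommGroup P] [Module K P] {U : Submodule K M} {V : Submodule K N}
    {z : M ⊗[K] N} (hz : z ∈ Submodule.map₂ (TensorProduct.mk K M N) U V)
    (f : M ⊗[K] N →ₗ[K] P) {Q : Submodule K P} (h : ∀ u ∈ U, ∀ v ∈ V, f (u ⊗ₜ v) ∈ Q) :
    f z ∈ Q := by
  have : Submodule.map₂ (TensorProduct.mk K M N) U V ≤ Q.comap f :=
    Submodule.map₂_le.2 h
  exact this hz

theorem corad_one (δ : L →ₗ[K] L ⊗[K] L) : corad δ 1 = LinearMap.ker δ := by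
  ext x
  simp [corad]

theorem corad_le_succ (δ : L →ₗ[K] L ⊗[K] L) (n : ℕ) : corad δ n ≤ corad δ (n + 1) := by
  induction n with
  | zero => simp [corad]
  | succ n ih => exact Submodule.comap_mono (Submodule.map₂_le_map₂_left ih)

/-- The composition of the coproduct with the product. -/
def euler (m : L →ₗ[K] L →ₗ[K] L) (δ : L →ₗ[K] L ⊗[K] L) : L →ₗ[K] L :=
  TensorProduct.lift m ∘ₗ δ

variable {m : L →ₗ[K] L →ₗ[K] L} {δ : L →ₗ[K] L ⊗[K] L} {H : ℕ → Submodule K L}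

/-- Both filtrations are needed: `E` is triangular for `corad`, which controls the left tensor
factor only, whereas inductions on both factors at once use `H`. -/
theorem IsConnectedFiltration.le_corad (hH : IsConnectedFiltration δ H) (n : ℕ) :
    H n ≤ corad δ n := by
  induction n with
  | zero => rw [hH.zero]; exact bot_le
  | succ n ih => exact fun x hx => Submodule.map₂_le_map₂ ih le_top (hH.succ n x hx)

theorem IsConnectedFiltration.exists_mem_corad (hH : IsConnectedFiltration δ H) (x : L) :
    ∃ n, x ∈ corad δ n :=
  (hH.exhaust x).imp fun n hn => hH.le_corad n hn

/-- `u ⊗ v ↦ u' ⊗ (u'' • v)`. -/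
def actRight (m : L →ₗ[K] L →ₗ[K] L) (δ : L →ₗ[K] L ⊗[K] L) : L ⊗[K] L →ₗ[K] L ⊗[K] L :=
  (TensorProduct.lift m).lTensor L ∘ₗ (TensorProduct.assoc K L L L).toLinearMap ∘ₗ δ.rTensor L

theorem actRight_tmul (u v : L) : actRight m δ (u ⊗ₜ v) = (m.flip v).lTensor L (δ u) := by
  simp only [actRight, LinearMap.comp_apply, LinearMap.rTensor_tmul]
  generalize δ u = z
  induction z with
  | zero => simp
  | add a b ha hb => simp only [TensorProduct.add_tmul, map_add, ha, hb]
  | tmul a b => simp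

/-- `u ⊗ v ↦ (u' • v) ⊗ u''`. -/
def actLeft (m : L →ₗ[K] L →ₗ[K] L) (δ : L →ₗ[K] L ⊗[K] L) : L ⊗[K] L →ₗ[K] L ⊗[K] L :=
  (TensorProduct.lift m).rTensor L ∘ₗ (TensorProduct.rightComm K L L L).toLinearMap ∘ₗ δ.rTensor L

theorem actLeft_tmul (u v : L) : actLeft m δ (u ⊗ₜ v) = (m.flip v).rTensor L (δ u) := by
  simp only [actLeft, LinearMap.comp_apply, LinearMap.rTensor_tmul]
  generalize δ u = z
  induction z with
  | zero => simp
  | add a b ha hb => simp only [TensorProduct.add_tmul, map_add, ha, hb]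
  | tmul a b => simp

theorem IsBialgebra.delta_lift (h : IsBialgebra m δ) (z : L ⊗[K] L) :
    δ (TensorProduct.lift m z) = z + actLeft m δ z + actRight m δ z := by
  induction z with
  | zero => simp
  | add a b ha hb => simp only [map_add, ha, hb]; abel
  | tmul a b =>
    rw [TensorProduct.lift.tmul, h.compat, actLeft_tmul, actRight_tmul, add_assoc]
    rfl

/-- In `δ (m u v)`, summed over `δ x = u ⊗ v`, the term `(u' • v) ⊗ u''` is read off `(δ ⊗ id) (δ
x)` by exchanging the last two factors. By `perm` the exchange is harmless, and the term becomes
`(u' • u'') ⊗ v = E u ⊗ v`. -/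
theorem IsBialgebra.delta_euler (h : IsBialgebra m δ) (x : L) :
    δ (euler m δ x) = δ x + (euler m δ).rTensor L (δ x) + actRight m δ (δ x) := by
  rw [euler, LinearMap.comp_apply, h.delta_lift, actLeft, LinearMap.comp_apply,
    LinearMap.comp_apply, LinearEquiv.coe_coe, ← h.perm, ← LinearMap.rTensor_comp_apply]

/-- In `δ (E x)` the summand `δ x` raises the eigenvalue by one at each level. The remaining term
`u' ⊗ (u'' • v)` drops one level further because its left factor comes from `δ u`. -/
theorem IsBialgebra.euler_sub_mem (h : IsBialgebra m δ) (n : ℕ) {x : L}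
    (hx : x ∈ corad δ (n + 1)) : euler m δ x - (n : K) • x ∈ corad δ n := by
  induction n generalizing x with
  | zero =>
    rw [corad_one, LinearMap.mem_ker] at hx
    simp [euler, hx]
  | succ n ih =>
    have h1 : δ (euler m δ x - ((n + 1 : ℕ) : K) • x) =
        (euler m δ - (n : K) • LinearMap.id).rTensor L (δ x) + actRight m δ (δ x) := by
      rw [map_sub, h.delta_euler, LinearMap.rTensor_sub, LinearMap.rTensor_smul,
        LinearMap.rTensor_id]
      simp only [map_add, map_smul, LinearMap.sub_apply, LinearMap.smul_apply,
        LinearMap.id_apply, Nat.cast_add, Nat.cast_one, add_smul, one_smul]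
      abel
    rw [mem_corad_succ, h1]
    refine add_mem ?_ ?_
    · refine map_mem_of_mem_map₂ hx _ fun u hu v hv => ?_
      exact Submodule.apply_mem_map₂ _ (ih hu) hv
    · refine map_mem_of_mem_map₂ hx _ fun u hu v hv => ?_
      rw [actRight_tmul]
      refine map_mem_of_mem_map₂ hu _ fun a ha b hb => ?_
      exact Submodule.apply_mem_map₂ _ ha trivial

theorem IsBialgebra.euler_mem (h : IsBialgebra m δ) {n : ℕ} {x : L}
    (hx : x ∈ corad δ n) : euler m δ x ∈ corad δ n := by
  cases n with
  | zero => rw [(Submodule.mem_bot K).1 hx]; simp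
  | succ n =>
    have := add_mem (corad_le_succ δ n (h.euler_sub_mem n hx)) (Submodule.smul_mem _ (n : K) hx)
    simpa using this

/-- `E x` is in `R` because `δ x` is in `R ⊗ R`, and `E x - n x` satisfies the same hypotheses as
`x` one level lower; their difference is `n x`. -/
theorem IsBialgebra.mem_of_delta_mem [CharZero K] (h : IsBialgebra m δ) {R : Submodule K L}
    (hker : LinearMap.ker δ ≤ R) (hm : ∀ x ∈ R, ∀ y ∈ R, m x y ∈ R)
    (hδ : ∀ x ∈ R, δ x ∈ Submodule.map₂ (TensorProduct.mk K L L) R R) (n : ℕ) {x : L}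
    (hx : x ∈ corad δ n) (hxR : δ x ∈ Submodule.map₂ (TensorProduct.mk K L L) R R) : x ∈ R := by
  induction n generalizing x with
  | zero => rw [(Submodule.mem_bot K).1 hx]; exact zero_mem R
  | succ n ih =>
    have h1 : euler m δ x ∈ R :=
      map_mem_of_mem_map₂ hxR (TensorProduct.lift m) fun u hu v hv => hm u hu v hv
    have h2 : euler m δ x - (n : K) • x ∈ R := by
      refine ih (h.euler_sub_mem n hx) ?_
      rw [map_sub, map_smul]
      exact sub_mem (hδ _ h1) (Submodule.smul_mem _ _ hxR)
    -- The eigenvalue 0 cannot be inverted, but it only occurs on `corad δ 1 = ker δ`.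
    rcases Nat.eq_zero_or_pos n with rfl | hn
    · exact hker (corad_one δ ▸ hx)
    · have h3 : (n : K) • x ∈ R := by simpa using sub_mem h1 h2
      exact (Submodule.smul_mem_iff R (Nat.cast_ne_zero.2 hn.ne')).1 h3

theorem IsBialgebra.mem_of_ker_le [CharZero K] (h : IsBialgebra m δ)
    (hH : IsConnectedFiltration δ H) {R : Submodule K L}
    (hker : LinearMap.ker δ ≤ R) (hm : ∀ x ∈ R, ∀ y ∈ R, m x y ∈ R)
    (hδ : ∀ x ∈ R, δ x ∈ Submodule.map₂ (TensorProduct.mk K L L) R R) (x : L) : x ∈ R := by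
  obtain ⟨n, hn⟩ := hH.exhaust x
  induction n generalizing x with
  | zero => rw [hH.zero] at hn; rw [(Submodule.mem_bot K).1 hn]; exact zero_mem R
  | succ n ih =>
    exact h.mem_of_delta_mem hker hm hδ (n + 1) (hH.le_corad _ hn)
      (Submodule.map₂_le_map₂ ih ih (hH.succ n x hn))

/-- Compatibility yields `(a' • b) • a'' + a' • (a'' • b)`, which the pre-Lie identity turns into
`(a' • a'') • b + a' • (b • a'')`; the first part sums to `E a • b`. -/
theorem IsBialgebra.euler_mul (h : IsBialgebra m δ) (a b : L) :
    euler m δ (m a b) = m a b + m (euler m δ a) b +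
      TensorProduct.lift (m.compl₂ (m b)) (δ a) := by
  rw [euler, LinearMap.comp_apply, h.compat, map_add, TensorProduct.lift.tmul, add_assoc,
    LinearMap.comp_apply]
  congr 1
  generalize δ a = z
  induction z with
  | zero => simp
  | add p q hp hq =>
    simp only [map_add, LinearMap.add_apply, hp, hq]
    abel
  | tmul p q =>
    rw [act_tmul, map_add]
    simp only [TensorProduct.lift.tmul, LinearMap.compl₂_apply]
    have := h.preLie p b q
    rw [sub_eq_sub_iff_add_eq_add] at this
    exact this

/-- In the formula for `E (a • b)`, `E a` is `n a` modulo the previous level and each `a'` lies in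
the previous level. Hence `(n + 1) (a • b)` is in the range, and `n + 1` is invertible even for `n =
0`. -/
theorem IsBialgebra.mul_mem_range_euler [CharZero K] (h : IsBialgebra m δ) (n : ℕ) {a : L}
    (ha : a ∈ corad δ n) (b : L) : m a b ∈ LinearMap.range (euler m δ) := by
  induction n generalizing a b with
  | zero => rw [(Submodule.mem_bot K).1 ha]; simp
  | succ n ih =>
    have h1 : m (euler m δ a - (n : K) • a) b ∈ LinearMap.range (euler m δ) :=
      ih (h.euler_sub_mem n ha) b
    have h2 : TensorProduct.lift (m.compl₂ (m b)) (δ a) ∈ LinearMap.range (euler m δ) :=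
      map_mem_of_mem_map₂ ha _ fun u hu v _ => ih hu _
    have h3 : euler m δ (m a b) ∈ LinearMap.range (euler m δ) := ⟨_, rfl⟩
    rw [h.euler_mul] at h3
    have h4 := sub_mem (sub_mem h3 h2) h1
    have h5 : m a b + m (euler m δ a) b + TensorProduct.lift (m.compl₂ (m b)) (δ a) -
        TensorProduct.lift (m.compl₂ (m b)) (δ a) - m (euler m δ a - (n : K) • a) b =
        ((n + 1 : ℕ) : K) • m a b := by
      simp only [map_sub, map_smul, LinearMap.sub_apply, LinearMap.smul_apply, Nat.cast_add,
        Nat.cast_one, add_smul, one_smul]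
      abel
    rw [h5] at h4
    exact (Submodule.smul_mem_iff _ (Nat.cast_ne_zero.2 n.succ_ne_zero)).1 h4

/-- The eigenvalue 0 has no Jordan block: a vector killed by `E ∘ E` descends through the levels
with nonzero eigenvalue until it reaches `ker δ`, where `E` vanishes. -/
theorem IsBialgebra.euler_eq_zero [CharZero K] (h : IsBialgebra m δ) (n : ℕ) {y : L}
    (hy : y ∈ corad δ n) (hT : euler m δ (euler m δ y) = 0) : euler m δ y = 0 := by
  induction n with
  | zero => rw [(Submodule.mem_bot K).1 hy]; simp
  | succ n ih =>
    rcases Nat.eq_zero_or_pos n with rfl | hn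
    · rw [corad_one, LinearMap.mem_ker] at hy
      simp [euler, hy]
    · refine ih ?_
      have h1 := h.euler_sub_mem n hy
      have h2 := h.euler_mem h1
      have h3 := add_mem h2 (Submodule.smul_mem _ (n : K) h1)
      -- With `z = E y - n y`, this is `E z + n z = E (E y) - n² y = - n² y`.
      rw [map_sub, hT, map_smul, smul_sub, zero_sub, neg_add_eq_sub] at h3
      have h4 : (n : K) • (n : K) • y ∈ corad δ n := by
        simpa using neg_mem h3
      have hn' : (n : K) ≠ 0 := Nat.cast_ne_zero.2 hn.ne'
      exact (Submodule.smul_mem_iff _ hn').1 ((Submodule.smul_mem_iff _ hn').1 h4)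

/-- The kernel of `δ` meets the span of the products trivially. -/
theorem IsBialgebra.eq_zero_of_mem_ker [CharZero K] (h : IsBialgebra m δ)
    (hH : IsConnectedFiltration δ H) {x : L} (hx : δ x = 0)
    (hx' : x ∈ Submodule.map₂ m ⊤ ⊤) : x = 0 := by
  have h1 : Submodule.map₂ m ⊤ ⊤ ≤ LinearMap.range (euler m δ) :=
    Submodule.map₂_le.2 fun a _ b _ => by
      obtain ⟨n, hn⟩ := hH.exists_mem_corad a
      exact h.mul_mem_range_euler n hn b
  -- Now `x = E y`, and `E x = 0` because `δ x = 0`, so `E (E y) = 0`.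
  obtain ⟨y, rfl⟩ := h1 hx'
  obtain ⟨n, hn⟩ := hH.exists_mem_corad y
  refine h.euler_eq_zero n hn ?_
  rw [euler, LinearMap.comp_apply, ← euler, hx, map_zero]

end PreLieRigidity

namespace PreLieRigidity

open TensorProduct

/-! ### The free pre-Lie algebra and its coproduct. -/

noncomputable section FreePreLie

variable (K : Type*) [Field K] (X : Type*)

/-- The product of the free nonassociative algebra generated by `X`. -/
def magmaMul : (FreeMagma X →₀ K) →ₗ[K] (FreeMagma X →₀ K) →ₗ[K] (FreeMagma X →₀ K) :=
  Finsupp.linearCombination K fun a => Finsupp.linearCombination K fun b =>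
    Finsupp.single (a * b) 1

@[simp]
theorem magmaMul_single (a b : FreeMagma X) :
    magmaMul K X (Finsupp.single a 1) (Finsupp.single b 1) = Finsupp.single (a * b) 1 := by
  simp [magmaMul]

/-- The two-sided ideals containing the pre-Lie relators. -/
structure IsPreLieIdeal (N : Submodule K (FreeMagma X →₀ K)) : Prop where
  relator : ∀ x y z, magmaMul K X (magmaMul K X x y) z - magmaMul K X x (magmaMul K X y z) -
    (magmaMul K X (magmaMul K X x z) y - magmaMul K X x (magmaMul K X z y)) ∈ N
  mul_right : ∀ x ∈ N, ∀ y, magmaMul K X x y ∈ N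
  mul_left : ∀ x, ∀ y ∈ N, magmaMul K X x y ∈ N

/-- The ideal generated by the pre-Lie relators. -/
def preLieIdeal : Submodule K (FreeMagma X →₀ K) := sInf {N | IsPreLieIdeal K X N}

theorem isPreLieIdeal_preLieIdeal : IsPreLieIdeal K X (preLieIdeal K X) where
  relator x y z := Submodule.mem_sInf.2 fun _ hN => hN.relator x y z
  mul_right x hx y := Submodule.mem_sInf.2 fun N hN =>
    hN.mul_right x (Submodule.mem_sInf.1 hx N hN) y
  mul_left x y hy := Submodule.mem_sInf.2 fun N hN =>
    hN.mul_left x y (Submodule.mem_sInf.1 hy N hN)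

/-- The free right pre-Lie algebra generated by `X`. -/
abbrev FreePreLie : Type _ := (FreeMagma X →₀ K) ⧸ preLieIdeal K X

namespace FreePreLie

/-- The class of a monomial. -/
def mon (a : FreeMagma X) : FreePreLie K X := (preLieIdeal K X).mkQ (Finsupp.single a 1)

/-- The pre-Lie product. -/
def mul : FreePreLie K X →ₗ[K] FreePreLie K X →ₗ[K] FreePreLie K X :=
  (preLieIdeal K X).liftQ
    -- The product passes to the quotient in its second argument, then, after flipping back, in its
    -- first.
    (((preLieIdeal K X).liftQ ((magmaMul K X).compr₂ (preLieIdeal K X).mkQ).flip (by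
      intro y hy
      ext x
      simpa [Submodule.Quotient.mk_eq_zero] using
        (isPreLieIdeal_preLieIdeal K X).mul_left _ y hy)).flip) (by
      intro x hx
      refine LinearMap.ext fun y => ?_
      obtain ⟨y, rfl⟩ := (preLieIdeal K X).mkQ_surjective y
      exact (Submodule.Quotient.mk_eq_zero _).2
        ((isPreLieIdeal_preLieIdeal K X).mul_right x hx y))

theorem mul_mkQ (x y : FreeMagma X →₀ K) :
    mul K X ((preLieIdeal K X).mkQ x) ((preLieIdeal K X).mkQ y) =
      (preLieIdeal K X).mkQ (magmaMul K X x y) := rfl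

theorem mul_mon (a b : FreeMagma X) : mul K X (mon K X a) (mon K X b) = mon K X (a * b) := by
  rw [mon, mon, mul_mkQ, magmaMul_single]
  rfl

theorem preLie (x y z : FreePreLie K X) :
    mul K X (mul K X x y) z - mul K X x (mul K X y z) =
      mul K X (mul K X x z) y - mul K X x (mul K X z y) := by
  obtain ⟨x, rfl⟩ := (preLieIdeal K X).mkQ_surjective x
  obtain ⟨y, rfl⟩ := (preLieIdeal K X).mkQ_surjective y
  obtain ⟨z, rfl⟩ := (preLieIdeal K X).mkQ_surjective z
  simp only [mul_mkQ, ← map_sub]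
  rw [← sub_eq_zero, ← map_sub, Submodule.mkQ_apply, Submodule.Quotient.mk_eq_zero]
  exact (isPreLieIdeal_preLieIdeal K X).relator x y z

variable {K X} {M : Type*} [AddCommGroup M] [Module K M]

theorem hom_ext {f g : FreePreLie K X →ₗ[K] M} (h : ∀ a, f (mon K X a) = g (mon K X a)) :
    f = g := by
  ext a
  exact h a

theorem mem_of_mon {N : Submodule K (FreePreLie K X)} (h : ∀ a, mon K X a ∈ N)
    (x : FreePreLie K X) : x ∈ N := by
  obtain ⟨x, rfl⟩ := (preLieIdeal K X).mkQ_surjective x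
  induction x using Finsupp.induction_linear with
  | zero => simp
  | add p q hp hq => rw [map_add]; exact add_mem hp hq
  | single a c =>
    rw [← mul_one c, ← smul_eq_mul, ← Finsupp.smul_single, map_smul]
    exact N.smul_mem c (h a)

section lift

variable (m : M →ₗ[K] M →ₗ[K] M) (f : X → M)

/-- The evaluation of a monomial in an algebra. -/
def evalMon : FreeMagma X → M
  | .of x => f x
  | .mul a b => m (evalMon a) (evalMon b)

/-- The evaluation of a nonassociative polynomial in an algebra. -/
def evalMagma : (FreeMagma X →₀ K) →ₗ[K] M := Finsupp.linearCombination K (evalMon m f)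

theorem evalMagma_mul (x y : FreeMagma X →₀ K) :
    evalMagma m f (magmaMul K X x y) = m (evalMagma m f x) (evalMagma m f y) := by
  have : (magmaMul K X).compr₂ (evalMagma m f) =
      (m.compl₁₂ (evalMagma m f) (evalMagma m f)) := by
    ext a b
    simp only [evalMagma, LinearMap.comp_apply, Finsupp.lsingle_apply, LinearMap.compr₂_apply,
      magmaMul_single, LinearMap.compl₁₂_apply, Finsupp.linearCombination_single, one_smul]
    rfl
  exact LinearMap.congr_fun₂ this x y

theorem preLieIdeal_le_ker_evalMagma
    (hm : ∀ x y z, m (m x y) z - m x (m y z) = m (m x z) y - m x (m z y)) :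
    preLieIdeal K X ≤ LinearMap.ker (evalMagma m f) := by
  refine sInf_le ⟨fun x y z => ?_, fun x hx y => ?_, fun x y hy => ?_⟩
  · rw [LinearMap.mem_ker]
    simp only [map_sub, evalMagma_mul]
    rw [hm, sub_self]
  · rw [LinearMap.mem_ker] at hx ⊢
    rw [evalMagma_mul, hx, map_zero, LinearMap.zero_apply]
  · rw [LinearMap.mem_ker] at hy ⊢
    rw [evalMagma_mul, hy, map_zero]

variable (hm : ∀ x y z, m (m x y) z - m x (m y z) = m (m x z) y - m x (m z y))

/-- The universal property of the free pre-Lie algebra. -/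
def lift : FreePreLie K X →ₗ[K] M :=
  (preLieIdeal K X).liftQ (evalMagma m f) (preLieIdeal_le_ker_evalMagma m f hm)

theorem lift_of (x : X) : lift m f hm (mon K X (.of x)) = f x := by
  simp [lift, mon, evalMagma, evalMon]

theorem lift_mul (x y : FreePreLie K X) :
    lift m f hm (mul K X x y) = m (lift m f hm x) (lift m f hm y) := by
  obtain ⟨x, rfl⟩ := (preLieIdeal K X).mkQ_surjective x
  obtain ⟨y, rfl⟩ := (preLieIdeal K X).mkQ_surjective y
  exact evalMagma_mul m f x y

end lift

variable (K X)

/-- The coproduct on monomials. -/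
def deltaMon : FreeMagma X → FreePreLie K X ⊗[K] FreePreLie K X
  | .of _ => 0
  | .mul a b => mon K X a ⊗ₜ mon K X b + act (mul K X) (mon K X b) (deltaMon a)

/-- The coproduct on nonassociative polynomials. -/
def deltaMagma : (FreeMagma X →₀ K) →ₗ[K] FreePreLie K X ⊗[K] FreePreLie K X :=
  Finsupp.linearCombination K (deltaMon K X)

/-- `act` as a bilinear map. -/
def actₗ {L : Type*} [AddCommGroup L] [Module K L] (m : L →ₗ[K] L →ₗ[K] L) :
    L →ₗ[K] L ⊗[K] L →ₗ[K] L ⊗[K] L :=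
  LinearMap.rTensorHom L ∘ₗ m.flip + LinearMap.lTensorHom L ∘ₗ m.flip

theorem actₗ_apply {L : Type*} [AddCommGroup L] [Module K L] (m : L →ₗ[K] L →ₗ[K] L) (y : L) :
    actₗ K m y = act m y := rfl

theorem deltaMagma_mul (x y : FreeMagma X →₀ K) :
    deltaMagma K X (magmaMul K X x y) =
      (preLieIdeal K X).mkQ x ⊗ₜ (preLieIdeal K X).mkQ y +
        act (mul K X) ((preLieIdeal K X).mkQ y) (deltaMagma K X x) := by
  have : (magmaMul K X).compr₂ (deltaMagma K X) =
      (TensorProduct.mk K _ _).compl₁₂ (preLieIdeal K X).mkQ (preLieIdeal K X).mkQ +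
        ((actₗ K (mul K X)).flip).compl₁₂ (deltaMagma K X) (preLieIdeal K X).mkQ := by
    ext a b
    simp only [deltaMagma, LinearMap.comp_apply, Finsupp.lsingle_apply, LinearMap.compr₂_apply,
      magmaMul_single, LinearMap.compl₁₂_apply, Finsupp.linearCombination_single, one_smul,
      LinearMap.add_apply, LinearMap.flip_apply, actₗ_apply]
    rfl
  exact LinearMap.congr_fun₂ this x y

/-- Each factor satisfies the pre-Lie identity, and the cross terms `(a • y) ⊗ (b • z) + (a • z) ⊗
(b • y)` are already symmetric in `y` and `z`. -/
theorem act_act {L : Type*} [AddCommGroup L] [Module K L] {m : L →ₗ[K] L →ₗ[K] L}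
    (hm : ∀ x y z, m (m x y) z - m x (m y z) = m (m x z) y - m x (m z y)) (y z : L)
    (w : L ⊗[K] L) :
    act m z (act m y w) - act m (m y z) w = act m y (act m z w) - act m (m z y) w := by
  induction w with
  | zero => simp
  | add p q hp hq =>
    simp only [map_add]
    rw [add_sub_add_comm, hp, hq, add_sub_add_comm]
  | tmul a b =>
    simp only [act_tmul, map_add]
    have h1 : m (m a y) z = m (m a z) y - m a (m z y) + m a (m y z) := by rw [← hm]; abel
    have h2 : m (m b y) z = m (m b z) y - m b (m z y) + m b (m y z) := by rw [← hm]; abel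
    rw [h1, h2]
    simp only [TensorProduct.add_tmul, TensorProduct.sub_tmul, TensorProduct.tmul_add,
      TensorProduct.tmul_sub]
    abel

theorem preLieIdeal_le_ker_deltaMagma :
    preLieIdeal K X ≤ LinearMap.ker (deltaMagma K X) := by
  have hI := isPreLieIdeal_preLieIdeal K X
  have hmk : ∀ x ∈ preLieIdeal K X, (preLieIdeal K X).mkQ x = 0 := fun x hx =>
    (Submodule.Quotient.mk_eq_zero _).2 hx
  -- The kernel alone is not visibly an ideal: `deltaMagma (x y)` also involves the classes of `x`
  -- and `y`. These vanish on the relation ideal, so the intersection is an ideal.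
  suffices h : IsPreLieIdeal K X (LinearMap.ker (deltaMagma K X) ⊓ preLieIdeal K X) from
    (sInf_le h).trans inf_le_left
  refine ⟨fun x y z => ⟨?_, hI.relator x y z⟩, fun x hx y => ⟨?_, hI.mul_right x hx.2 y⟩,
    fun x y hy => ⟨?_, hI.mul_left x y hy.2⟩⟩
  · rw [SetLike.mem_coe, LinearMap.mem_ker]
    simp only [map_sub, deltaMagma_mul, map_add, ← mul_mkQ, act_tmul]
    have := act_act K (preLie K X) ((preLieIdeal K X).mkQ y) ((preLieIdeal K X).mkQ z)
      (deltaMagma K X x)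
    rw [sub_eq_iff_eq_add] at this
    rw [this]
    abel
  · have := hx.1
    rw [SetLike.mem_coe, LinearMap.mem_ker] at this ⊢
    rw [deltaMagma_mul, this, hmk x hx.2, map_zero, TensorProduct.zero_tmul, add_zero]
  · rw [SetLike.mem_coe, LinearMap.mem_ker, deltaMagma_mul, hmk y hy.2, TensorProduct.tmul_zero,
      zero_add, ← actₗ_apply, map_zero, LinearMap.zero_apply]

/-- The coproduct of the free pre-Lie algebra. -/
def delta : FreePreLie K X →ₗ[K] FreePreLie K X ⊗[K] FreePreLie K X :=
  (preLieIdeal K X).liftQ (deltaMagma K X) (preLieIdeal_le_ker_deltaMagma K X)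

theorem delta_of (x : X) : delta K X (mon K X (.of x)) = 0 := by
  simp [delta, mon, deltaMagma, deltaMon]

theorem delta_mul (x y : FreePreLie K X) :
    delta K X (mul K X x y) = x ⊗ₜ y + act (mul K X) y (delta K X x) := by
  obtain ⟨x, rfl⟩ := (preLieIdeal K X).mkQ_surjective x
  obtain ⟨y, rfl⟩ := (preLieIdeal K X).mkQ_surjective y
  exact deltaMagma_mul K X x y

/-- The right action of `y` on `L ⊗ L ⊗ L` by derivation. -/
def act₃ {L : Type*} [AddCommGroup L] [Module K L] (m : L →ₗ[K] L →ₗ[K] L) (y : L) :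
    (L ⊗[K] L) ⊗[K] L →ₗ[K] (L ⊗[K] L) ⊗[K] L :=
  (act m y).rTensor L + (m.flip y).lTensor (L ⊗[K] L)

theorem act₃_rightComm {L : Type*} [AddCommGroup L] [Module K L] (m : L →ₗ[K] L →ₗ[K] L) (y : L)
    (w : (L ⊗[K] L) ⊗[K] L) :
    act₃ K m y (TensorProduct.rightComm K L L L w) =
      TensorProduct.rightComm K L L L (act₃ K m y w) := by
  have : act₃ K m y ∘ₗ (TensorProduct.rightComm K L L L).toLinearMap =
      (TensorProduct.rightComm K L L L).toLinearMap ∘ₗ act₃ K m y := by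
    ext a b c
    simp [act₃, act_tmul, TensorProduct.add_tmul]
    abel
  exact LinearMap.congr_fun this w

/-- Of the two terms containing `y` as a factor, `δ x ⊗ y` comes from `x ⊗ y`. Its exchange comes
from the `a ⊗ y` in `δ (a • y)`, for `a ⊗ b` in `δ x`. The rest is the derivation action. -/
theorem delta_delta_mul {L : Type*} [AddCommGroup L] [Module K L] {m : L →ₗ[K] L →ₗ[K] L}
    {δ : L →ₗ[K] L ⊗[K] L} (h : ∀ x y, δ (m x y) = x ⊗ₜ y + act m y (δ x)) (x y : L) :
    δ.rTensor L (δ (m x y)) = δ x ⊗ₜ y + TensorProduct.rightComm K L L L (δ x ⊗ₜ y) +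
      act₃ K m y (δ.rTensor L (δ x)) := by
  rw [h, map_add, LinearMap.rTensor_tmul, add_assoc]
  congr 1
  generalize δ x = w
  induction w with
  | zero => simp
  | add p q hp hq => simp only [map_add, TensorProduct.add_tmul, hp, hq]; abel
  | tmul a b =>
    simp [act_tmul, h, TensorProduct.add_tmul, act₃]
    abel

/-- By induction on monomials: in `delta_delta_mul` the first two terms are exchanged with each
other, and the last is symmetric because the derivation action commutes with the exchange. -/
theorem delta_perm (x : FreePreLie K X) :
    (delta K X).rTensor _ (delta K X x) =
      TensorProduct.rightComm K _ _ _ ((delta K X).rTensor _ (delta K X x)) := by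
  have : (delta K X).rTensor (FreePreLie K X) ∘ₗ delta K X =
      (TensorProduct.rightComm K (FreePreLie K X) (FreePreLie K X) (FreePreLie K X)).toLinearMap ∘ₗ
        (delta K X).rTensor (FreePreLie K X) ∘ₗ delta K X := by
    refine hom_ext (M := (FreePreLie K X ⊗[K] FreePreLie K X) ⊗[K] FreePreLie K X) fun a => ?_
    induction a with
    | ih1 x => simp [delta_of]
    | ih2 a b iha _ =>
      simp only [LinearMap.comp_apply, LinearEquiv.coe_coe] at iha ⊢
      rw [← mul_mon, delta_delta_mul K (delta_mul K X), map_add, map_add, ← act₃_rightComm,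
        ← iha]
      congr 1
      rw [add_comm]
      congr 1
      generalize delta K X (mon K X a) = w
      induction w with
      | zero => simp
      | add p q hp hq => simp only [map_add, TensorProduct.add_tmul, ← hp, ← hq]
      | tmul p q => simp
  exact LinearMap.congr_fun this x

theorem isBialgebra : IsBialgebra (mul K X) (delta K X) where
  preLie := preLie K X
  perm := delta_perm K X
  compat := delta_mul K X

/-- The span of the monomials of length at most `n`. -/
def filt (n : ℕ) : Submodule K (FreePreLie K X) :=
  Submodule.span K (mon K X '' {a | a.length ≤ n})

theorem mon_mem_filt {n : ℕ} {a : FreeMagma X} (h : a.length ≤ n) : mon K X a ∈ filt K X n :=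
  Submodule.subset_span ⟨a, h, rfl⟩

theorem filt_mono {m n : ℕ} (h : m ≤ n) : filt K X m ≤ filt K X n :=
  Submodule.span_mono (Set.image_mono fun _ ha => le_trans ha h)

theorem mul_mem_filt {p q n : ℕ} {x y : FreePreLie K X} (hx : x ∈ filt K X p)
    (hy : y ∈ filt K X q) (h : p + q ≤ n) : mul K X x y ∈ filt K X n := by
  have : Submodule.map₂ (mul K X) (filt K X p) (filt K X q) ≤ filt K X n := by
    rw [filt, filt, Submodule.map₂_span_span, Submodule.span_le]
    rintro _ ⟨_, ⟨a, ha, rfl⟩, _, ⟨b, hb, rfl⟩, rfl⟩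
    change mul K X (mon K X a) (mon K X b) ∈ _
    rw [mul_mon]
    refine mon_mem_filt K X ?_
    simp only [Set.mem_ofPred_eq] at ha hb
    change a.length + b.length ≤ n
    omega
  exact this (Submodule.apply_mem_map₂ _ hx hy)

theorem deltaMon_mem (a : FreeMagma X) (n : ℕ) (h : a.length ≤ n + 1) :
    delta K X (mon K X a) ∈ Submodule.map₂ (TensorProduct.mk K _ _) (filt K X n) (filt K X n) := by
  induction a generalizing n with
  | ih1 x => rw [delta_of]; exact zero_mem _
  | ih2 a b iha _ =>
    have h' : a.length + b.length ≤ n + 1 := h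
    have ha := a.length_pos
    have hb := b.length_pos
    rw [← mul_mon, delta_mul]
    refine add_mem (Submodule.apply_mem_map₂ _ (mon_mem_filt K X (by omega))
      (mon_mem_filt K X (by omega))) ?_
    -- Both factors of the coproduct of `a` have length at most `a.length - 1`; this lost unit
    -- leaves room for `b` within length `n`.
    refine map_mem_of_mem_map₂ (iha (a.length - 1) (by omega)) _ fun u hu v hv => ?_
    rw [act_tmul]
    refine add_mem (Submodule.apply_mem_map₂ _ ?_ ?_) (Submodule.apply_mem_map₂ _ ?_ ?_)
    · exact mul_mem_filt K X hu (mon_mem_filt K X le_rfl) (by omega)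
    · exact filt_mono K X (by omega) hv
    · exact filt_mono K X (by omega) hu
    · exact mul_mem_filt K X hv (mon_mem_filt K X le_rfl) (by omega)

theorem isConnectedFiltration : IsConnectedFiltration (delta K X) (filt K X) where
  zero := by
    rw [filt, Submodule.span_eq_bot]
    rintro _ ⟨a, ha, rfl⟩
    exact absurd a.length_pos (by simpa using ha)
  succ n x hx := by
    have : filt K X (n + 1) ≤ (Submodule.map₂ (TensorProduct.mk K _ _) (filt K X n)
        (filt K X n)).comap (delta K X) := by
      rw [filt, Submodule.span_le]
      rintro _ ⟨a, ha, rfl⟩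
      exact deltaMon_mem K X a n ha
    exact this hx
  exhaust x := by
    have hm : Monotone (filt K X) := fun _ _ h => filt_mono K X h
    have : x ∈ ⨆ n, filt K X n :=
      mem_of_mon (fun a => Submodule.mem_iSup_of_mem a.length (mon_mem_filt K X le_rfl)) x
    exact (Submodule.mem_iSup_of_directed _ hm.directed_le).1 this

/-- Every element is a combination of generators plus a sum of products. Generators are killed by
the coproduct, so the sum of products is too, and then it is zero by `eq_zero_of_mem_ker`. -/
theorem ker_delta_le [CharZero K] :
    LinearMap.ker (delta K X) ≤ Submodule.span K (Set.range fun x => mon K X (.of x)) := by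
  intro x hx
  have h1 : x ∈ Submodule.span K (Set.range fun x => mon K X (.of x)) ⊔
      Submodule.map₂ (mul K X) ⊤ ⊤ := by
    refine mem_of_mon (fun a => ?_) x
    cases a with
    | of x => exact Submodule.mem_sup_left (Submodule.subset_span ⟨x, rfl⟩)
    | mul a b =>
      refine Submodule.mem_sup_right ?_
      change mon K X (a * b) ∈ _
      rw [← mul_mon]
      exact Submodule.apply_mem_map₂ _ trivial trivial
  obtain ⟨p, hp, q, hq, rfl⟩ := Submodule.mem_sup.1 h1
  have h2 : Submodule.span K (Set.range fun x => mon K X (.of x)) ≤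
      LinearMap.ker (delta K X) := by
    rw [Submodule.span_le]
    rintro _ ⟨x, rfl⟩
    exact delta_of K X x
  have h3 : delta K X q = 0 := by
    have := LinearMap.mem_ker.1 hx
    rwa [map_add, LinearMap.mem_ker.1 (h2 hp), zero_add] at this
  rw [(isBialgebra K X).eq_zero_of_mem_ker (isConnectedFiltration K X) h3 hq, add_zero]
  exact hp

end FreePreLie

end FreePreLie

/-! ### The rigidity theorem. -/

noncomputable section Rigidity

variable {K : Type*} [Field K] {L : Type*} [AddCommGroup L] [Module K L]
  {m : L →ₗ[K] L →ₗ[K] L} {δ : L →ₗ[K] L ⊗[K] L} {H : ℕ → Submodule K L}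

/-- The morphism to `L` from the free pre-Lie algebra on a basis of `ker δ`. -/
def fromFree (h : IsBialgebra m δ) {X : Type*} (b : Module.Basis X K (LinearMap.ker δ)) :
    FreePreLie K X →ₗ[K] L :=
  FreePreLie.lift m (fun x => (b x : L)) h.preLie

variable (h : IsBialgebra m δ) {X : Type*} (b : Module.Basis X K (LinearMap.ker δ))

theorem fromFree_mul (x y : FreePreLie K X) :
    fromFree h b (FreePreLie.mul K X x y) = m (fromFree h b x) (fromFree h b y) :=
  FreePreLie.lift_mul m _ h.preLie x y

/-- Both sides vanish on generators, which are sent into `ker δ`, and obey the same rule on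
products. -/
theorem delta_fromFree (x : FreePreLie K X) :
    δ (fromFree h b x) =
      TensorProduct.map (fromFree h b) (fromFree h b) (FreePreLie.delta K X x) := by
  have : δ ∘ₗ fromFree h b =
      TensorProduct.map (fromFree h b) (fromFree h b) ∘ₗ FreePreLie.delta K X := by
    refine FreePreLie.hom_ext fun a => ?_
    induction a with
    | ih1 x =>
      simp only [LinearMap.comp_apply, FreePreLie.delta_of, map_zero]
      rw [fromFree, FreePreLie.lift_of]
      exact (b x).2
    | ih2 a c iha _ =>
      simp only [LinearMap.comp_apply] at iha ⊢
      rw [← FreePreLie.mul_mon, FreePreLie.delta_mul, map_add, TensorProduct.map_tmul]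
      rw [fromFree_mul, h.compat, iha]
      congr 1
      generalize FreePreLie.delta K X (FreePreLie.mon K X a) = w
      induction w with
      | zero => simp
      | add p q hp hq => simp only [map_add, hp, hq]
      | tmul p q =>
        simp only [act_tmul, TensorProduct.map_tmul, map_add, fromFree_mul]
  exact LinearMap.congr_fun this x

/-- Over a field the tensor square of an injective map is injective, by flatness; this is applied to
the restriction of `f` to `U`. -/
theorem map_injOn_map₂ {M N : Type*} [AddCommGroup M] [Module K M] [AddCommGroup N] [Module K N]
    {f : M →ₗ[K] N} {U : Submodule K M} (hf : ∀ x ∈ U, f x = 0 → x = 0) {z : M ⊗[K] M}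
    (hz : z ∈ Submodule.map₂ (TensorProduct.mk K M M) U U)
    (h0 : TensorProduct.map f f z = 0) : z = 0 := by
  have h1 : z ∈ LinearMap.range (TensorProduct.map U.subtype U.subtype) := by
    refine map_mem_of_mem_map₂ hz LinearMap.id fun u hu v hv => ?_
    exact ⟨⟨u, hu⟩ ⊗ₜ ⟨v, hv⟩, rfl⟩
  obtain ⟨w, rfl⟩ := h1
  rw [← LinearMap.comp_apply, ← TensorProduct.map_comp] at h0
  have hinj : Function.Injective (f ∘ₗ U.subtype) := by
    rw [injective_iff_map_eq_zero]
    intro a ha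
    exact Subtype.ext (hf a a.2 ha)
  have h2 : Function.Injective (TensorProduct.map (f ∘ₗ U.subtype) (f ∘ₗ U.subtype)) :=
    TensorProduct.map_injective_of_flat_flat _ _ hinj hinj
  rw [(injective_iff_map_eq_zero _).1 h2 w h0, map_zero]

/-- By induction on the degree: if `x` is sent to 0, so is its coproduct, whose factors have smaller
degree, hence `x` is primitive. It is then a combination of generators, whose images are linearly
independent. -/
theorem fromFree_injective [CharZero K] : Function.Injective (fromFree h b) := by
  rw [injective_iff_map_eq_zero]
  have hc := FreePreLie.isConnectedFiltration K X
  intro x hx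
  obtain ⟨n, hn⟩ := hc.exhaust x
  induction n generalizing x with
  | zero => rw [hc.zero] at hn; exact (Submodule.mem_bot K).1 hn
  | succ n ih =>
    have h1 : FreePreLie.delta K X x = 0 := by
      refine map_injOn_map₂ (f := fromFree h b) (fun y hy h0 => ih y h0 hy) (hc.succ n x hn) ?_
      rw [← delta_fromFree, hx, map_zero]
    have h2 := FreePreLie.ker_delta_le K X h1
    rw [Finsupp.mem_span_range_iff_exists_finsupp] at h2
    obtain ⟨c, rfl⟩ := h2
    have h3 : Finsupp.linearCombination K b c = 0 := by
      refine Subtype.ext ?_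
      rw [Finsupp.sum, map_sum] at hx
      simp only [map_smul, fromFree, FreePreLie.lift_of] at hx
      simpa [Finsupp.linearCombination_apply, Finsupp.sum] using hx
    have h4 : c = 0 := by
      have := b.linearIndependent
      exact (linearIndependent_iff.1 this) c h3
    rw [h4, Finsupp.sum_zero_index]

theorem fromFree_surjective [CharZero K] (hH : IsConnectedFiltration δ H) :
    Function.Surjective (fromFree h b) := by
  refine fun x => h.mem_of_ker_le (R := LinearMap.range (fromFree h b)) hH ?_ ?_ ?_ x
  · intro y hy
    have h1 : (LinearMap.ker δ).subtype.range ≤ LinearMap.range (fromFree h b) := by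
      rw [LinearMap.range_eq_map, ← b.span_eq, Submodule.map_span, Submodule.span_le]
      rintro _ ⟨_, ⟨i, rfl⟩, rfl⟩
      exact ⟨FreePreLie.mon K X (.of i), FreePreLie.lift_of _ _ _ _⟩
    exact h1 ⟨⟨y, hy⟩, rfl⟩
  · rintro _ ⟨p, rfl⟩ _ ⟨q, rfl⟩
    exact ⟨FreePreLie.mul K X p q, FreePreLie.lift_mul _ _ _ _ _⟩
  · rintro _ ⟨p, rfl⟩
    rw [delta_fromFree]
    generalize FreePreLie.delta K X p = w
    induction w with
    | zero => simp
    | add p q hp hq => rw [map_add]; exact add_mem hp hq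
    | tmul p q => exact Submodule.apply_mem_map₂ _ ⟨p, rfl⟩ ⟨q, rfl⟩

/-- A connected pre-Lie algebra with a compatible NAP coproduct `δ` is freely generated by the
kernel of `δ`. -/
theorem existsUnique_hom [CharZero K] (h : IsBialgebra m δ) (hH : IsConnectedFiltration δ H)
    {A : Type*} [AddCommGroup A] [Module K A] (μ : A →ₗ[K] A →ₗ[K] A)
    (hμ : ∀ x y z, μ (μ x y) z - μ x (μ y z) = μ (μ x z) y - μ x (μ z y))
    (f : LinearMap.ker δ →ₗ[K] A) :
    ∃! φ : L →ₗ[K] A, (∀ x y, φ (m x y) = μ (φ x) (φ y)) ∧ ∀ x : LinearMap.ker δ, φ x = f x := by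
  let b := Module.Basis.ofVectorSpace K (LinearMap.ker δ)
  let e : FreePreLie K _ ≃ₗ[K] L :=
    LinearEquiv.ofBijective (fromFree h b) ⟨fromFree_injective h b, fromFree_surjective h b hH⟩
  have he_mul : ∀ x y, e (FreePreLie.mul K _ x y) = m (e x) (e y) := FreePreLie.lift_mul m _ h.preLie
  have he_of : ∀ i, e (FreePreLie.mon K _ (.of i)) = b i := FreePreLie.lift_of m _ h.preLie
  let g := FreePreLie.lift μ (fun i => f (b i)) hμ
  refine ⟨g ∘ₗ e.symm.toLinearMap, ⟨fun x y => ?_, fun x => ?_⟩, fun φ ⟨hφ, hφf⟩ => ?_⟩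
  · obtain ⟨x, rfl⟩ := e.surjective x
    obtain ⟨y, rfl⟩ := e.surjective y
    simp only [LinearMap.comp_apply, LinearEquiv.coe_coe, e.symm_apply_apply, ← he_mul]
    exact FreePreLie.lift_mul _ _ _ _ _
  · have : (g ∘ₗ e.symm.toLinearMap) ∘ₗ (LinearMap.ker δ).subtype = f := by
      refine b.ext fun i => ?_
      simp only [LinearMap.comp_apply, Submodule.subtype_apply, LinearEquiv.coe_coe]
      rw [← he_of, e.symm_apply_apply]
      exact FreePreLie.lift_of _ _ _ _
    exact LinearMap.congr_fun this x
  · have : φ ∘ₗ e.toLinearMap = g := by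
      refine FreePreLie.hom_ext fun a => ?_
      induction a with
      | ih1 i =>
        simp only [LinearMap.comp_apply, LinearEquiv.coe_coe]
        rw [he_of, hφf]
        exact (FreePreLie.lift_of μ (fun i => f (b i)) hμ i).symm
      | ih2 a c iha ihc =>
        simp only [LinearMap.comp_apply, LinearEquiv.coe_coe] at iha ihc ⊢
        rw [← FreePreLie.mul_mon, he_mul, hφ, iha, ihc]
        exact (FreePreLie.lift_mul μ _ hμ _ _).symm
    rw [← this]
    ext x
    simp

end Rigidity

end PreLieRigidity

/-! ### Iterated graftings and joins of partitioned forests. -/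

namespace PForest

variable {D : Type u} {V W V' : Type*}

/-- Isomorphisms from the relation between a vertex and its direct descendant. -/
def Iso.ofIff {F : PForest D V} {G : PForest D W} (e : V ≃ W)
    (hp : ∀ x y, G.parent (e x) = some (e y) ↔ F.parent x = some y)
    (hr : ∀ x y, G.part.r (e x) (e y) ↔ F.part.r x y) (hd : ∀ x, G.deco (e x) = F.deco x) :
    F.Iso G where
  e := e
  map_parent x := by
    rcases h : F.parent x with _ | y
    · rcases h' : G.parent (e x) with _ | z
      · rfl
      · rw [← e.apply_symm_apply z, hp, h] at h'
        cases h'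
    · exact (hp x y).2 h
  map_part := hr
  map_deco := hd

section graft

variable (F : PForest D V) (s : V) (G : PForest D W)

@[simp]
theorem graft_parent_inl_inl (a a' : V) :
    (F.graft s G).parent (.inl a) = some (.inl a') ↔ F.parent a = some a' := by
  simp [graft]

@[simp]
theorem graft_parent_inl_inr (a : V) (b : W) :
    ¬ (F.graft s G).parent (.inl a) = some (.inr b) := by
  simp [graft]

@[simp]
theorem graft_parent_inr_inl (b : W) (a : V) :
    (F.graft s G).parent (.inr b) = some (.inl a) ↔ G.parent b = none ∧ a = s := by
  rcases h : G.parent b with _ | c <;> simp [graft, h, eq_comm]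

@[simp]
theorem graft_parent_inr_inr (b b' : W) :
    (F.graft s G).parent (.inr b) = some (.inr b') ↔ G.parent b = some b' := by
  rcases h : G.parent b with _ | c <;> simp [graft, h]

@[simp]
theorem graft_parent_inl_none (a : V) :
    (F.graft s G).parent (.inl a) = none ↔ F.parent a = none := by
  simp [graft]

@[simp]
theorem graft_parent_inr_none (b : W) : ¬ (F.graft s G).parent (.inr b) = none := by
  simp [graft]

@[simp]
theorem graft_part_inl_inl (a a' : V) :
    (F.graft s G).part.r (.inl a) (.inl a') ↔ F.part.r a a' :=
  Sum.liftRel_inl_inl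

@[simp]
theorem graft_part_inl_inr (a : V) (b : W) : ¬ (F.graft s G).part.r (.inl a) (.inr b) :=
  Sum.not_liftRel_inl_inr

@[simp]
theorem graft_part_inr_inl (a : V) (b : W) : ¬ (F.graft s G).part.r (.inr b) (.inl a) :=
  Sum.not_liftRel_inr_inl

@[simp]
theorem graft_part_inr_inr (b b' : W) :
    (F.graft s G).part.r (.inr b) (.inr b') ↔ G.part.r b b' :=
  Sum.liftRel_inr_inr

@[simp]
theorem graft_deco_inl (a : V) : (F.graft s G).deco (.inl a) = F.deco a := rfl

@[simp]
theorem graft_deco_inr (b : W) : (F.graft s G).deco (.inr b) = G.deco b := rfl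

end graft

section join

variable (F : PForest D V) (G : PForest D W)

@[simp]
theorem join_parent_inl_inl (a a' : V) :
    (F.join G).parent (.inl a) = some (.inl a') ↔ F.parent a = some a' := by
  simp [join]

@[simp]
theorem join_parent_inl_inr (a : V) (b : W) :
    ¬ (F.join G).parent (.inl a) = some (.inr b) := by
  simp [join]

@[simp]
theorem join_parent_inr_inl (b : W) (a : V) :
    ¬ (F.join G).parent (.inr b) = some (.inl a) := by
  simp [join]

@[simp]
theorem join_parent_inr_inr (b b' : W) :
    (F.join G).parent (.inr b) = some (.inr b') ↔ G.parent b = some b' := by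
  simp [join]

@[simp]
theorem join_parent_inl_none (a : V) :
    (F.join G).parent (.inl a) = none ↔ F.parent a = none := by
  simp [join]

@[simp]
theorem join_parent_inr_none (b : W) :
    (F.join G).parent (.inr b) = none ↔ G.parent b = none := by
  simp [join]

@[simp]
theorem join_part_inl_inl (a a' : V) :
    (F.join G).part.r (.inl a) (.inl a') ↔
      F.part.r a a' ∨ (F.parent a = none ∧ F.parent a' = none) := by
  change Sum.LiftRel F.part.r G.part.r _ _ ∨ _ ↔ _
  simp

@[simp]
theorem join_part_inl_inr (a : V) (b : W) :
    (F.join G).part.r (.inl a) (.inr b) ↔ F.parent a = none ∧ G.parent b = none := by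
  change Sum.LiftRel F.part.r G.part.r _ _ ∨ _ ↔ _
  simp

@[simp]
theorem join_part_inr_inl (a : V) (b : W) :
    (F.join G).part.r (.inr b) (.inl a) ↔ G.parent b = none ∧ F.parent a = none := by
  change Sum.LiftRel F.part.r G.part.r _ _ ∨ _ ↔ _
  simp

@[simp]
theorem join_part_inr_inr (b b' : W) :
    (F.join G).part.r (.inr b) (.inr b') ↔
      G.part.r b b' ∨ (G.parent b = none ∧ G.parent b' = none) := by
  change Sum.LiftRel F.part.r G.part.r _ _ ∨ _ ↔ _
  simp

@[simp]
theorem join_deco_inl (a : V) : (F.join G).deco (.inl a) = F.deco a := rfl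

@[simp]
theorem join_deco_inr (b : W) : (F.join G).deco (.inr b) = G.deco b := rfl

end join

/-- Grafting two forests on two vertices of a third one, in either order. -/
def graftGraftComm (F : PForest D V) (s r : V) (G : PForest D W) (H : PForest D V') :
    ((F.graft s G).graft (.inl r) H).Iso ((F.graft r H).graft (.inl s) G) :=
  .ofIff ((Equiv.sumAssoc V W V').trans
      (((Equiv.refl V).sumCongr (Equiv.sumComm W V')).trans (Equiv.sumAssoc V V' W).symm))
    (by rintro ((a | b) | c) ((a' | b') | c') <;> simp)
    (by rintro ((a | b) | c) ((a' | b') | c') <;> simp)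
    (by rintro ((a | b) | c) <;> simp)

/-- Grafting on a grafted forest. -/
def graftGraftAssoc (F : PForest D V) (s : V) (G : PForest D W) (r : W) (H : PForest D V') :
    ((F.graft s G).graft (.inr r) H).Iso (F.graft s (G.graft r H)) :=
  .ofIff (Equiv.sumAssoc V W V')
    (by rintro ((a | b) | c) ((a' | b') | c') <;> simp)
    (by rintro ((a | b) | c) ((a' | b') | c') <;> simp)
    (by rintro ((a | b) | c) <;> simp)

def joinComm (F : PForest D V) (G : PForest D W) : (F.join G).Iso (G.join F) :=
  .ofIff (Equiv.sumComm V W)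
    (by rintro (a | b) (a' | b') <;> simp)
    (by rintro (a | b) (a' | b') <;> simp)
    (by rintro (a | b) <;> simp)

def joinAssoc (F : PForest D V) (G : PForest D W) (H : PForest D V') :
    ((F.join G).join H).Iso (F.join (G.join H)) :=
  .ofIff (Equiv.sumAssoc V W V')
    (by rintro ((a | b) | c) ((a' | b') | c') <;> simp)
    (by rintro ((a | b) | c) ((a' | b') | c') <;> simp)
    (by rintro ((a | b) | c) <;> simp)

/-- Grafting on the left summand of a product. -/
def joinGraftLeft (F : PForest D V) (G : PForest D W) (s : V) (H : PForest D V') :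
    ((F.join G).graft (.inl s) H).Iso ((F.graft s H).join G) :=
  .ofIff ((Equiv.sumAssoc V W V').trans
      (((Equiv.refl V).sumCongr (Equiv.sumComm W V')).trans (Equiv.sumAssoc V V' W).symm))
    (by rintro ((a | b) | c) ((a' | b') | c') <;> simp)
    (by rintro ((a | b) | c) ((a' | b') | c') <;> simp)
    (by rintro ((a | b) | c) <;> simp)

/-- Grafting on the right summand of a product. -/
def joinGraftRight (F : PForest D V) (G : PForest D W) (s : W) (H : PForest D V') :
    ((F.join G).graft (.inr s) H).Iso (F.join (G.graft s H)) :=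
  .ofIff (Equiv.sumAssoc V W V')
    (by rintro ((a | b) | c) ((a' | b') | c') <;> simp)
    (by rintro ((a | b) | c) ((a' | b') | c') <;> simp)
    (by rintro ((a | b) | c) <;> simp)

end PForest

namespace PT

variable {D : Type u}

theorem ind_mk {p : PT D → Prop}
    (h : ∀ (n : ℕ) (F : PForest D (Fin n)) (hF : F.IsTree), p (mk F hF)) (t : PT D) : p t := by
  induction t using Quotient.inductionOn with
  | _ t =>
    have : mk t.forest t.isTree = Quotient.mk (FinPTree.setoid D) t :=
      Quotient.sound ⟨(t.forest.mapIso _).symm⟩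
    rw [← this]
    exact h _ _ _

end PT

/-! ### The Com-Prelie axioms. -/

noncomputable section

namespace GPT

open PForest

variable {K : Type v} [Field K] {D : Type u} {V W : Type*}

theorem induction_tree {p : GPT K D → Prop} (zero : p 0) (add : ∀ x y, p x → p y → p (x + y))
    (smul : ∀ (c : K) x, p x → p (c • x))
    (tree : ∀ (n : ℕ) (F : PForest D (Fin n)) (hF : F.IsTree),
      p (Finsupp.single (PT.mk F hF) 1)) (x : GPT K D) : p x := by
  induction x using Finsupp.induction_linear with
  | zero => exact zero
  | add x y hx hy => exact add x y hx hy
  | single t c =>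
    rw [← mul_one c, ← smul_eq_mul, ← Finsupp.smul_single]
    exact smul c _ (PT.ind_mk (p := fun t => p (Finsupp.single t 1)) tree t)

variable (K)

/-- The basis element of a partitioned tree. -/
def tree [Finite V] (F : PForest D V) (hF : F.IsTree) : GPT K D :=
  Finsupp.single (PT.mk F hF) 1

variable {K}

theorem tree_congr [Finite V] [Finite W] {F : PForest D V} {G : PForest D W} (hF : F.IsTree)
    (hG : G.IsTree) (i : F.Iso G) : tree K F hF = tree K G hG := by
  rw [tree, PT.mk_eq_mk_iff.2 ⟨i⟩, tree]

/-- Arbitrary finite vertex types let sums and subtypes serve as vertex sets, so that no renumbering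
by `Fin n` appears later. -/
theorem bullet_tree [Fintype V] [Finite W] (F : PForest D V) (hF : F.IsTree) (G : PForest D W)
    (hG : G.IsTree) :
    bullet K D (tree K F hF) (tree K G hG) = ∑ s : V, tree K (F.graft s G) (hF.graft s G) := by
  have h : bullet K D (tree K F hF) (tree K G hG) = graftSum K D (PT.mk F hF) (PT.mk G hG) := by
    simp [bullet, tree]
  rw [h]
  refine (Fintype.sum_equiv (Finite.equivFin V) _ _ fun s => ?_).symm
  rw [tree, PT.mk_eq_mk_iff.2 ⟨(F.mapIso (Finite.equivFin V)).graft s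
    (G.mapIso (Finite.equivFin W))⟩]
  rfl

theorem shuffle_tree [Finite V] [Finite W] (F : PForest D V) (hF : F.IsTree) (G : PForest D W)
    (hG : G.IsTree) :
    shuffle K D (tree K F hF) (tree K G hG) = tree K (F.join G) (hF.join G) := by
  have h : shuffle K D (tree K F hF) (tree K G hG) =
      Finsupp.single (join D (PT.mk F hF) (PT.mk G hG)) 1 := by
    simp [shuffle, tree]
  rw [h]
  exact tree_congr (((F.mapIso (Finite.equivFin V)).isTree hF).join _) _
    ((F.mapIso (Finite.equivFin V)).join (G.mapIso (Finite.equivFin W))).symm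

variable (K D)

theorem bullet_preLie (x y z : GPT K D) :
    bullet K D (bullet K D x y) z - bullet K D x (bullet K D y z) =
      bullet K D (bullet K D x z) y - bullet K D x (bullet K D z y) := by
  induction x using induction_tree with
  | zero => simp
  | add a b ha hb =>
    simp only [map_add, LinearMap.add_apply]
    rw [add_sub_add_comm, ha, hb, add_sub_add_comm]
  | smul c a ha => simp only [map_smul, LinearMap.smul_apply, ← smul_sub, ha]
  | tree n F hF =>
  induction y using induction_tree with
  | zero => simp
  | add a b ha hb =>
    simp only [map_add, LinearMap.add_apply]
    rw [add_sub_add_comm, ha, hb, add_sub_add_comm]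
  | smul c a ha => simp only [map_smul, LinearMap.smul_apply, ← smul_sub, ha]
  | tree p G hG =>
  induction z using induction_tree with
  | zero => simp
  | add a b ha hb =>
    simp only [map_add, LinearMap.add_apply]
    rw [add_sub_add_comm, ha, hb, add_sub_add_comm]
  | smul c a ha => simp only [map_smul, LinearMap.smul_apply, ← smul_sub, ha]
  | tree q H hH =>
    change bullet K D (bullet K D (tree K F hF) (tree K G hG)) (tree K H hH) -
      bullet K D (tree K F hF) (bullet K D (tree K G hG) (tree K H hH)) =
      bullet K D (bullet K D (tree K F hF) (tree K H hH)) (tree K G hG) -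
      bullet K D (tree K F hF) (bullet K D (tree K H hH) (tree K G hG))
    simp only [bullet_tree, map_sum, LinearMap.sum_apply, Fintype.sum_sum_type,
      Finset.sum_add_distrib]
    rw [Finset.sum_comm (s := (Finset.univ : Finset (Fin p))),
      Finset.sum_comm (s := (Finset.univ : Finset (Fin q)))]
    -- Grafting the last tree on a vertex of the middle one gives the terms of the subtracted
    -- product; after cancellation both trees are grafted on vertices of `F`.
    simp only [tree_congr _ ((hF.graft _ _)) (graftGraftAssoc F _ G _ H),
      tree_congr _ ((hF.graft _ _)) (graftGraftAssoc F _ H _ G), add_sub_cancel_right]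
    rw [Finset.sum_comm]
    simp only [tree_congr _ ((hF.graft _ _).graft _ _) (graftGraftComm F _ _ G H)]

theorem shuffle_comm (x y : GPT K D) : shuffle K D x y = shuffle K D y x := by
  induction x using induction_tree with
  | zero => simp
  | add a b ha hb => simp only [map_add, LinearMap.add_apply, ha, hb]
  | smul c a ha => simp only [map_smul, LinearMap.smul_apply, ha]
  | tree n F hF =>
  induction y using induction_tree with
  | zero => simp
  | add a b ha hb => simp only [map_add, LinearMap.add_apply, ha, hb]
  | smul c a ha => simp only [map_smul, LinearMap.smul_apply, ha]
  | tree p G hG =>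
    change shuffle K D (tree K F hF) (tree K G hG) = shuffle K D (tree K G hG) (tree K F hF)
    rw [shuffle_tree, shuffle_tree, tree_congr _ _ (joinComm F G)]

theorem shuffle_assoc (x y z : GPT K D) :
    shuffle K D (shuffle K D x y) z = shuffle K D x (shuffle K D y z) := by
  induction x using induction_tree with
  | zero => simp
  | add a b ha hb => simp only [map_add, LinearMap.add_apply, ha, hb]
  | smul c a ha => simp only [map_smul, LinearMap.smul_apply, ha]
  | tree n F hF =>
  induction y using induction_tree with
  | zero => simp
  | add a b ha hb => simp only [map_add, LinearMap.add_apply, ha, hb]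
  | smul c a ha => simp only [map_smul, LinearMap.smul_apply, ha]
  | tree p G hG =>
  induction z using induction_tree with
  | zero => simp
  | add a b ha hb => simp only [map_add, ha, hb]
  | smul c a ha => simp only [map_smul, ha]
  | tree q H hH =>
    change shuffle K D (shuffle K D (tree K F hF) (tree K G hG)) (tree K H hH) =
      shuffle K D (tree K F hF) (shuffle K D (tree K G hG) (tree K H hH))
    simp only [shuffle_tree]
    exact tree_congr _ _ (joinAssoc F G H)

theorem bullet_shuffle (x y z : GPT K D) :
    bullet K D (shuffle K D x y) z =
      shuffle K D (bullet K D x z) y + shuffle K D x (bullet K D y z) := by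
  induction x using induction_tree with
  | zero => simp
  | add a b ha hb =>
    simp only [map_add, LinearMap.add_apply, ha, hb]
    abel
  | smul c a ha => simp only [map_smul, LinearMap.smul_apply, ← smul_add, ha]
  | tree n F hF =>
  induction y using induction_tree with
  | zero => simp
  | add a b ha hb =>
    simp only [map_add, LinearMap.add_apply, ha, hb]
    abel
  | smul c a ha => simp only [map_smul, LinearMap.smul_apply, ← smul_add, ha]
  | tree p G hG =>
  induction z using induction_tree with
  | zero => simp
  | add a b ha hb =>
    simp only [map_add, LinearMap.add_apply, ha, hb]
    abel
  | smul c a ha => simp only [map_smul, LinearMap.smul_apply, ← smul_add, ha]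
  | tree q H hH =>
    change bullet K D (shuffle K D (tree K F hF) (tree K G hG)) (tree K H hH) =
      shuffle K D (bullet K D (tree K F hF) (tree K H hH)) (tree K G hG) +
        shuffle K D (tree K F hF) (bullet K D (tree K G hG) (tree K H hH))
    simp only [shuffle_tree, bullet_tree, map_sum, LinearMap.sum_apply, Fintype.sum_sum_type]
    congr 1
    · exact Finset.sum_congr rfl fun s _ => tree_congr _ _ (joinGraftLeft F G s H)
    · exact Finset.sum_congr rfl fun s _ => tree_congr _ _ (joinGraftRight F G s H)

theorem isComPreLie : IsComPreLie (bullet K D) (shuffle K D) where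
  preLie := bullet_preLie K D
  comm := shuffle_comm K D
  assoc := shuffle_assoc K D
  leibniz := bullet_shuffle K D

end GPT

end

/-! ### Induced forests, branches and trunks. -/

namespace PForest

variable {D : Type u} {V W : Type*}

theorem exists_root [Nonempty V] (F : PForest D V) : ∃ x, F.parent x = none := by
  obtain ⟨x, -, hx⟩ := F.wf.has_min Set.univ Set.univ_nonempty
  refine ⟨x, ?_⟩
  rcases h : F.parent x with _ | y
  · rfl
  · exact absurd h (hx y trivial)

theorem numRoots_ne_zero [Finite V] {F : PForest D V} (hF : F.IsTree) : F.numRoots ≠ 0 := by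
  have := hF.nonempty
  obtain ⟨x, hx⟩ := F.exists_root
  have : Nonempty {x // F.parent x = none} := ⟨⟨x, hx⟩⟩
  exact Nat.card_pos.ne'

theorem numRoots_graft (F : PForest D V) (s : V) (G : PForest D W) :
    (F.graft s G).numRoots = F.numRoots := by
  refine (Nat.card_congr (Equiv.ofBijective (fun x : {x // F.parent x = none} =>
    (⟨.inl x.1, by simp [x.2]⟩ : {x // (F.graft s G).parent x = none})) ⟨?_, ?_⟩)).symm
  · rintro ⟨x, hx⟩ ⟨y, hy⟩ h
    simpa using h
  · rintro ⟨a | b, h⟩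
    · exact ⟨⟨a, by simpa using h⟩, rfl⟩
    · simp at h

@[simp]
theorem restrict_parent_eq_some (F : PForest D V) (S : Set V) (x y : S) :
    (F.restrict S).parent x = some y ↔ F.parent x = some y.1 := by
  classical
  rcases h : F.parent x with _ | z
  · simp [restrict, h]
  · by_cases hz : z ∈ S
    · simp [restrict, h, hz, Subtype.ext_iff]
    · simp only [restrict, h, Option.bind_some, hz, dite_false, Option.some.injEq, reduceCtorEq,
        false_iff]
      rintro rfl
      exact hz y.2

@[simp]
theorem restrict_part (F : PForest D V) (S : Set V) (x y : S) :
    (F.restrict S).part.r x y ↔ F.part.r x y := Iff.rfl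

@[simp]
theorem restrict_deco (F : PForest D V) (S : Set V) (x : S) :
    (F.restrict S).deco x = F.deco x := rfl

/-- A set stable under `parent` creates no new root. Trunks are of this kind, branches are not. -/
theorem restrict_parent_eq_none_iff (F : PForest D V) {S : Set V}
    (hS : ∀ x y, F.parent x = some y → x ∈ S → y ∈ S) (x : S) :
    (F.restrict S).parent x = none ↔ F.parent x = none := by
  rcases h : F.parent x with _ | z
  · simp [restrict, h]
  · have hz := hS _ _ h x.2
    simp [restrict, h, hz]

theorem IsTree.restrict {F : PForest D V} (hF : F.IsTree) {S : Set V}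
    (hS : ∀ x y, F.parent x = some y → x ∈ S → y ∈ S) (hne : S.Nonempty) :
    (F.restrict S).IsTree where
  nonempty := hne.to_subtype
  roots x y hx hy := hF.roots _ _ ((F.restrict_parent_eq_none_iff hS x).1 hx)
    ((F.restrict_parent_eq_none_iff hS y).1 hy)

/-- An embedding of a forest as an induced forest. -/
noncomputable def isoRestrict {F : PForest D V} {G : PForest D W} (S : Set V) (j : W → V)
    (hj : Function.Injective j) (hS : ∀ x, x ∈ S ↔ ∃ w, j w = x)
    (hp : ∀ x y, F.parent (j x) = some (j y) ↔ G.parent x = some y)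
    (hr : ∀ x y, F.part.r (j x) (j y) ↔ G.part.r x y) (hd : ∀ x, F.deco (j x) = G.deco x) :
    G.Iso (F.restrict S) :=
  .ofIff (Equiv.ofBijective (fun w => (⟨j w, (hS _).2 ⟨w, rfl⟩⟩ : S))
      ⟨fun x y h => hj (Subtype.ext_iff.1 h), fun ⟨x, hx⟩ => by
        obtain ⟨w, rfl⟩ := (hS x).1 hx
        exact ⟨w, rfl⟩⟩)
    (fun x y => (restrict_parent_eq_some F S _ _).trans (hp x y)) hr hd

/-- Grafting on an induced forest. -/
noncomputable def restrictGraftIso (F : PForest D V) (s : V) (G : PForest D W) (S : Set V)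
    (hs : s ∈ S) (T : Set (V ⊕ W)) (hl : ∀ a, .inl a ∈ T ↔ a ∈ S) (hr : ∀ b, .inr b ∈ T) :
    ((F.restrict S).graft ⟨s, hs⟩ G).Iso ((F.graft s G).restrict T) :=
  isoRestrict T (Sum.map Subtype.val id) (Subtype.val_injective.sumMap Function.injective_id)
    (by rintro (a | b) <;> simp [hl, hr])
    (by rintro (a | b) (a' | b') <;> simp [Subtype.ext_iff])
    (by rintro (a | b) (a' | b') <;> simp)
    (by rintro (a | b) <;> simp)

/-- The forests induced by a grafting on the vertices of the first forest. -/
noncomputable def restrictInlIso (F : PForest D V) (s : V) (G : PForest D W) (S : Set V)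
    (T : Set (V ⊕ W)) (hl : ∀ a, .inl a ∈ T ↔ a ∈ S) (hr : ∀ b, .inr b ∉ T) :
    (F.restrict S).Iso ((F.graft s G).restrict T) :=
  isoRestrict T (fun a => Sum.inl a.1) (fun a b h => Subtype.ext (Sum.inl.inj h))
    (by rintro (a | b) <;> simp [hl, hr])
    (by simp) (by simp) (by simp)

/-- The first forest is induced by a grafting. -/
noncomputable def graftInlIso (F : PForest D V) (s : V) (G : PForest D W)
    (T : Set (V ⊕ W)) (hl : ∀ a, .inl a ∈ T) (hr : ∀ b, .inr b ∉ T) :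
    F.Iso ((F.graft s G).restrict T) :=
  isoRestrict T Sum.inl Sum.inl_injective
    (by rintro (a | b) <;> simp [hl, hr])
    (by simp) (by simp) (by simp)

/-- The grafted forest is induced by a grafting. -/
noncomputable def graftInrIso (F : PForest D V) (s : V) (G : PForest D W)
    (T : Set (V ⊕ W)) (hl : ∀ a, .inl a ∉ T) (hr : ∀ b, .inr b ∈ T) :
    G.Iso ((F.graft s G).restrict T) :=
  isoRestrict T Sum.inr Sum.inr_injective
    (by rintro (a | b) <;> simp [hl, hr])
    (by simp) (by simp) (by simp)

/-- Transitivity of induction. -/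
noncomputable def restrictRestrictIso (F : PForest D V) (S : Set V) (T : Set S) (U : Set V)
    (hU : ∀ x, x ∈ U ↔ ∃ h : x ∈ S, ⟨x, h⟩ ∈ T) :
    ((F.restrict S).restrict T).Iso (F.restrict U) :=
  isoRestrict U (fun x => x.1.1) (fun x y h => Subtype.ext (Subtype.ext h))
    (fun x => by
      rw [hU]
      exact ⟨fun ⟨h, h'⟩ => ⟨⟨⟨x, h⟩, h'⟩, rfl⟩, by rintro ⟨⟨⟨x, h⟩, h'⟩, rfl⟩; exact ⟨h, h'⟩⟩)
    (by simp) (by simp) (by simp)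

/-- One-step form of membership, fit for induction along `parent`. -/
theorem mem_branchSet_step (F : PForest D V) (J : Quotient F.part) (x : V) :
    x ∈ F.branchSet J ↔
      Quotient.mk F.part x = J ∨ ∃ y, F.parent x = some y ∧ y ∈ F.branchSet J := by
  constructor
  · rintro ⟨y, hy, h⟩
    rcases h.cases_head with rfl | ⟨c, hc, hcy⟩
    · exact .inl hy
    · exact .inr ⟨c, hc, y, hy, hcy⟩
  · rintro (h | ⟨y, hy, z, hz, hyz⟩)
    · exact ⟨x, h, .refl⟩
    · exact ⟨z, hz, .head hy hyz⟩

theorem compl_branchSet_closed (F : PForest D V) (J : Quotient F.part) (x y : V)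
    (h : F.parent x = some y) (hx : x ∈ (F.branchSet J)ᶜ) : y ∈ (F.branchSet J)ᶜ :=
  fun hy => hx ((F.mem_branchSet_step J x).2 (.inr ⟨y, h, hy⟩))

theorem IsFirstPart.parent {F : PForest D V} {x : V}
    (h : F.IsFirstPart (Quotient.mk F.part x)) : ∃ r, F.parent x = some r ∧ F.parent r = none := by
  obtain ⟨y, r, hy, hyr, hr⟩ := h
  exact ⟨r, (F.parent_eq (Quotient.exact hy)).symm.trans hyr, hr⟩

/-- A first part contains no root, so both cuts of an iterated coproduct carry the same factor
`1/k`. -/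
theorem numRoots_trunk (F : PForest D V) {J : Quotient F.part} (hJ : F.IsFirstPart J) :
    (F.trunk J).numRoots = F.numRoots := by
  refine Nat.card_congr (Equiv.ofBijective (fun x : {x // (F.trunk J).parent x = none} =>
    (⟨x.1.1, (F.restrict_parent_eq_none_iff (F.compl_branchSet_closed J) x.1).1 x.2⟩ :
      {x // F.parent x = none})) ⟨?_, ?_⟩)
  · rintro ⟨⟨x, hx⟩, hx'⟩ ⟨⟨y, hy⟩, hy'⟩ h
    simpa using h
  · rintro ⟨x, hx⟩
    exact ⟨⟨⟨x, F.notMem_branchSet_of_root hJ hx⟩,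
      (F.restrict_parent_eq_none_iff (F.compl_branchSet_closed J) _).2 hx⟩, rfl⟩

/-! ### Parts and branches of a grafting. -/

section graftParts

variable (F : PForest D V) (s : V) (G : PForest D W)

/-- The parts of the first forest, as parts of a grafting. -/
def partInl : Quotient F.part → Quotient (F.graft s G).part :=
  Quotient.map Sum.inl fun _ _ h => (graft_part_inl_inl F s G _ _).2 h

theorem partInl_injective : Function.Injective (partInl F s G) := by
  intro J J'
  induction J using Quotient.inductionOn with | _ x
  induction J' using Quotient.inductionOn with | _ y
  intro h
  exact Quotient.sound ((graft_part_inl_inl F s G x y).1 (Quotient.exact h))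

theorem mk_inl (a : V) :
    Quotient.mk (F.graft s G).part (.inl a) = partInl F s G (Quotient.mk F.part a) := rfl

theorem mk_inr_ne_partInl (b : W) (J : Quotient F.part) :
    Quotient.mk (F.graft s G).part (.inr b) ≠ partInl F s G J := by
  induction J using Quotient.inductionOn with | _ x
  intro h
  exact graft_part_inr_inl F s G x b (Quotient.exact h)

theorem isFirstPart_partInl {J : Quotient F.part} (hJ : F.IsFirstPart J) :
    (F.graft s G).IsFirstPart (partInl F s G J) := by
  obtain ⟨x, r, rfl, hx, hr⟩ := hJ
  exact ⟨.inl x, .inl r, rfl, by simpa using hx, by simpa using hr⟩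

theorem inl_mem_branchSet (J : Quotient F.part) (a : V) :
    .inl a ∈ (F.graft s G).branchSet (partInl F s G J) ↔ a ∈ F.branchSet J := by
  induction a using F.wf.induction with
  | _ a ih =>
    rw [mem_branchSet_step, mem_branchSet_step F, mk_inl, (partInl_injective F s G).eq_iff]
    refine or_congr Iff.rfl ⟨?_, ?_⟩
    · rintro ⟨a' | b, h, h'⟩
      · rw [graft_parent_inl_inl] at h
        exact ⟨a', h, (ih a' h).1 h'⟩
      · exact absurd h (graft_parent_inl_inr F s G a b)
    · rintro ⟨a', h, h'⟩
      exact ⟨.inl a', (graft_parent_inl_inl F s G a a').2 h, (ih a' h).2 h'⟩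

/-- Going down from a vertex of `G` always passes through `s`, so the grafted tree follows `s` in
every cut at a part of `F`. -/
theorem inr_mem_branchSet (J : Quotient F.part) (b : W) :
    .inr b ∈ (F.graft s G).branchSet (partInl F s G J) ↔ s ∈ F.branchSet J := by
  induction b using G.wf.induction with
  | _ b ih =>
    rw [mem_branchSet_step, or_iff_right (mk_inr_ne_partInl F s G b J)]
    constructor
    · rintro ⟨a | c, h, h'⟩
      · obtain ⟨-, rfl⟩ := (graft_parent_inr_inl F s G b a).1 h
        exact (inl_mem_branchSet F a G J a).1 h'
      · exact (ih c ((graft_parent_inr_inr F s G b c).1 h)).1 h'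
    · intro h
      rcases hb : G.parent b with _ | c
      · exact ⟨.inl s, by simp [hb], (inl_mem_branchSet F s G J s).2 h⟩
      · exact ⟨.inr c, by simp [hb], (ih c hb).2 h⟩

variable {G}

theorem inl_notMem_branchSet_inr (b : W) (a : V) :
    .inl a ∉ (F.graft s G).branchSet (Quotient.mk _ (.inr b)) := by
  induction a using F.wf.induction with
  | _ a ih =>
    rw [mem_branchSet_step]
    rintro (h | ⟨a' | c, h, h'⟩)
    · exact graft_part_inl_inr F s G a b (Quotient.exact h)
    · exact ih a' ((graft_parent_inl_inl F s G a a').1 h) h'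
    · exact graft_parent_inl_inr F s G a c h

theorem inr_mem_branchSet_inr (hG : G.IsTree) {b : W} (hb : G.parent b = none) (c : W) :
    .inr c ∈ (F.graft s G).branchSet (Quotient.mk _ (.inr b)) := by
  induction c using G.wf.induction with
  | _ c ih =>
    rw [mem_branchSet_step]
    rcases hc : G.parent c with _ | d
    · exact .inl (Quotient.sound ((graft_part_inr_inr F s G c b).2 (hG.roots c b hc hb)))
    · exact .inr ⟨.inr d, by simp [hc], ih d hc⟩

variable {F s} in
theorem isFirstPart_inr (hs : F.parent s = none) {b : W} (hb : G.parent b = none) :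
    (F.graft s G).IsFirstPart (Quotient.mk _ (.inr b)) :=
  ⟨.inr b, .inl s, rfl, by simp [hb], by simp [hs]⟩

/-- The first parts of a grafting: those of the first forest, and the part of the roots of the
grafted tree if they are grafted on a root. -/
noncomputable def graftFirstParts (hG : G.IsTree) {b : W} (hb : G.parent b = none) :
    {J // F.IsFirstPart J} ⊕ {_u : Unit // F.parent s = none} ≃
      {J // (F.graft s G).IsFirstPart J} :=
  Equiv.ofBijective (Sum.elim
    (fun J => ⟨partInl F s G J.1, isFirstPart_partInl F s G J.2⟩)
    (fun u => ⟨Quotient.mk _ (.inr b), isFirstPart_inr u.2 hb⟩)) <| by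
    constructor
    · rintro (⟨J, hJ⟩ | ⟨u, hu⟩) (⟨J', hJ'⟩ | ⟨u', hu'⟩) h
      · have := partInl_injective F s G (Subtype.ext_iff.1 h)
        simpa using this
      · exact absurd (Subtype.ext_iff.1 h).symm (mk_inr_ne_partInl F s G b J)
      · exact absurd (Subtype.ext_iff.1 h) (mk_inr_ne_partInl F s G b J')
      · rfl
    · rintro ⟨J, x, r, rfl, hx, hr⟩
      rcases r with r | c
      · have hr' := (graft_parent_inl_none F s G r).1 hr
        rcases x with a | d
        · rw [graft_parent_inl_inl] at hx
          exact ⟨.inl ⟨Quotient.mk _ a, a, r, rfl, hx, hr'⟩, rfl⟩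
        · obtain ⟨hd, rfl⟩ := (graft_parent_inr_inl F s G d r).1 hx
          refine ⟨.inr ⟨(), hr'⟩, Subtype.ext (Quotient.sound ?_)⟩
          exact (graft_part_inr_inr F r G b d).2 (hG.roots b d hb hd)
      · exact absurd hr (graft_parent_inr_none F s G c)

end graftParts

/-! ### Cutting two branches. -/

section trunkParts

variable (F : PForest D V) (J : Quotient F.part)

/-- The parts of a trunk, as parts of the forest. -/
noncomputable def partVal : Quotient (F.trunk J).part → Quotient F.part :=
  Quotient.map Subtype.val fun _ _ h => h

theorem partVal_injective : Function.Injective (partVal F J) := by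
  intro I I'
  induction I using Quotient.inductionOn with | _ x
  induction I' using Quotient.inductionOn with | _ y
  intro h
  exact Quotient.sound (show F.part.r x y from Quotient.exact h)

theorem mem_branchSet_trunk (I : Quotient (F.trunk J).part) (x : ((F.branchSet J)ᶜ : Set V)) :
    x ∈ (F.trunk J).branchSet I ↔ x.1 ∈ F.branchSet (partVal F J I) := by
  induction x using (F.trunk J).wf.induction with
  | _ x ih =>
    rw [mem_branchSet_step, mem_branchSet_step F]
    refine or_congr ((partVal_injective F J).eq_iff (a := Quotient.mk _ x)).symm ⟨?_, ?_⟩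
    · rintro ⟨y, h, h'⟩
      exact ⟨y, (restrict_parent_eq_some F _ x y).1 h, (ih y h).1 h'⟩
    · rintro ⟨y, h, h'⟩
      have hy := F.compl_branchSet_closed J x y h x.2
      have h2 : (F.trunk J).parent x = some ⟨y, hy⟩ := (restrict_parent_eq_some F _ x ⟨y, hy⟩).2 h
      exact ⟨⟨y, hy⟩, h2, (ih ⟨y, hy⟩ h2).2 h'⟩

variable {F J}

/-- Going down from a common vertex, the path would meet one of the two parts first. Its next vertex
is a root, so the path could no longer meet the other. -/
theorem notMem_branchSet_of_ne (hJ : F.IsFirstPart J) {I : Quotient F.part} (hI : F.IsFirstPart I)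
    (hne : I ≠ J) (x : V) (hx : x ∈ F.branchSet I) : x ∉ F.branchSet J := by
  induction x using F.wf.induction with
  | _ x ih =>
    intro hx'
    rcases (F.mem_branchSet_step I x).1 hx with rfl | ⟨y, hy, hyI⟩
    · obtain ⟨r, hr, hr'⟩ := hI.parent
      rcases (F.mem_branchSet_step J x).1 hx' with rfl | ⟨y, hy, hyJ⟩
      · exact hne rfl
      · rw [hr, Option.some.injEq] at hy
        exact F.notMem_branchSet_of_root hJ (hy ▸ hr') hyJ
    · rcases (F.mem_branchSet_step J x).1 hx' with rfl | ⟨z, hz, hzJ⟩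
      · obtain ⟨r, hr, hr'⟩ := hJ.parent
        rw [hr, Option.some.injEq] at hy
        exact F.notMem_branchSet_of_root hI (hy ▸ hr') hyI
      · rw [hy, Option.some.injEq] at hz
        exact ih y hy hyI (hz ▸ hzJ)

/-- The first parts of a trunk are the other first parts of the forest. -/
noncomputable def trunkFirstParts (hJ : F.IsFirstPart J) :
    {I // (F.trunk J).IsFirstPart I} ≃
      {I : {I // F.IsFirstPart I} // I ≠ ⟨J, hJ⟩} :=
  Equiv.ofBijective (fun I => ⟨⟨partVal F J I.1, by
      obtain ⟨I, x, r, rfl, hx, hr⟩ := I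
      exact ⟨x, r, rfl, (restrict_parent_eq_some F _ x r).1 hx,
        (F.restrict_parent_eq_none_iff (F.compl_branchSet_closed J) r).1 hr⟩⟩, by
      obtain ⟨I, x, r, rfl, hx, hr⟩ := I
      intro h
      exact x.2 ((F.mem_branchSet_step J x).2 (.inl (Subtype.ext_iff.1 h)))⟩) <| by
    constructor
    · rintro ⟨I, hI⟩ ⟨I', hI'⟩ h
      simp only [Subtype.mk.injEq] at h
      exact Subtype.ext (partVal_injective F J h)
    · rintro ⟨⟨I, hI⟩, hne⟩
      have hne' : I ≠ J := fun h => hne (Subtype.ext h)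
      obtain ⟨x, r, rfl, hx, hr⟩ := id hI
      have hxJ : x ∈ (F.branchSet J)ᶜ := notMem_branchSet_of_ne hJ hI hne' x
        ((F.mem_branchSet_step _ x).2 (.inl rfl))
      have hrJ : r ∈ (F.branchSet J)ᶜ := F.notMem_branchSet_of_root hJ hr
      exact ⟨⟨Quotient.mk _ ⟨x, hxJ⟩, ⟨x, hxJ⟩, ⟨r, hrJ⟩, rfl,
        (restrict_parent_eq_some F _ _ _).2 hx,
        (F.restrict_parent_eq_none_iff (F.compl_branchSet_closed J) _).2 hr⟩, rfl⟩

theorem IsTree.trunk₂ (hF : F.IsTree) (hJ : F.IsFirstPart J) {I : Quotient F.part}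
    (hI : F.IsFirstPart I) : (F.restrict (F.branchSet J ∪ F.branchSet I)ᶜ).IsTree := by
  refine hF.restrict (fun x y h hx => ?_) ?_
  · rw [Set.compl_union] at hx ⊢
    exact ⟨F.compl_branchSet_closed J x y h hx.1, F.compl_branchSet_closed I x y h hx.2⟩
  · obtain ⟨x, r, -, -, hr⟩ := id hJ
    refine ⟨r, ?_⟩
    rw [Set.compl_union]
    exact ⟨F.notMem_branchSet_of_root hJ hr, F.notMem_branchSet_of_root hI hr⟩

variable (F J) in
/-- Cutting two branches. -/
noncomputable def trunkTrunkIso (I : Quotient (F.trunk J).part) :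
    ((F.trunk J).trunk I).Iso (F.restrict (F.branchSet J ∪ F.branchSet (partVal F J I))ᶜ) :=
  restrictRestrictIso F _ _ _ fun x => by
    simp only [Set.compl_union, Set.mem_inter_iff, Set.mem_compl_iff, mem_branchSet_trunk]
    exact ⟨fun h => ⟨h.1, h.2⟩, fun ⟨h, h'⟩ => ⟨h, h'⟩⟩

/-- A branch of a trunk. -/
noncomputable def trunkBranchIso (hJ : F.IsFirstPart J) (I : Quotient (F.trunk J).part)
    (hI : F.IsFirstPart (partVal F J I)) (hne : partVal F J I ≠ J) :
    ((F.trunk J).branch I).Iso (F.branch (partVal F J I)) :=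
  restrictRestrictIso F _ _ _ fun x => by
    simp only [mem_branchSet_trunk]
    exact ⟨fun h => ⟨notMem_branchSet_of_ne hJ hI hne x h, h⟩, fun ⟨_, h'⟩ => h'⟩

end trunkParts

end PForest

/-! ### Compatibility and symmetry of the coproduct, and rigidity for trees. -/

noncomputable section

namespace GPT

open PForest

variable {K : Type v} [Field K] {D : Type u} {V W : Type*}

theorem delta_tree [Finite V] (F : PForest D V) (hF : F.IsTree)
    [Fintype {J // F.IsFirstPart J}] :
    delta K D (tree K F hF) = (F.numRoots : K)⁻¹ • ∑ J : {J // F.IsFirstPart J},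
      tree K (F.trunk J.1) (hF.trunk J.2) ⊗ₜ[K] tree K (F.branch J.1) (.branch J.1) := by
  classical
  have h : delta K D (tree K F hF) = cutSum K D (PT.mk F hF) := by
    simp [delta, tree]
  let i := F.mapIso (Finite.equivFin V)
  rw [h, i.numRoots]
  refine congrArg (_ • ·) ?_
  refine (Fintype.sum_equiv (i.parts.subtypeEquiv fun J => ⟨i.isFirstPart J, fun h => ?_⟩) _ _
    fun J => ?_).symm
  · have := i.symm.isFirstPart _ h
    rwa [show i.symm.parts (i.parts J) = J from i.parts.symm_apply_apply J] at this
  · rw [tree_congr (hF.trunk J.2) ((i.isTree hF).trunk (i.isFirstPart _ J.2)) (i.trunk J.1),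
      tree_congr (.branch J.1) (.branch _) (i.branch J.1)]
    rfl

/-- The roots of `G` form a new first part exactly when `s` is a root, and cutting there undoes the
grafting. -/
theorem delta_tree_graft [Finite V] [Finite W] (F : PForest D V) (hF : F.IsTree) (s : V)
    (G : PForest D W) (hG : G.IsTree) [Fintype {J // F.IsFirstPart J}]
    [Decidable (F.parent s = none)] :
    delta K D (tree K (F.graft s G) (hF.graft s G)) = (F.numRoots : K)⁻¹ •
      (∑ J : {J // F.IsFirstPart J},
        tree K ((F.graft s G).trunk (partInl F s G J.1))
            ((hF.graft s G).trunk (isFirstPart_partInl F s G J.2)) ⊗ₜ[K]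
          tree K ((F.graft s G).branch (partInl F s G J.1)) (.branch _) +
        if F.parent s = none then tree K F hF ⊗ₜ[K] tree K G hG else 0) := by
  classical
  have := hG.nonempty
  obtain ⟨b, hb⟩ := G.exists_root
  have := Fintype.ofFinite {J // (F.graft s G).IsFirstPart J}
  rw [delta_tree, numRoots_graft]
  congr 1
  rw [← (graftFirstParts F s hG hb).sum_comp, Fintype.sum_sum_type]
  congr 1
  by_cases hs : F.parent s = none
  · rw [if_pos hs]
    have : Unique {_u : Unit // F.parent s = none} := ⟨⟨⟨(), hs⟩⟩, fun _ => rfl⟩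
    rw [Fintype.sum_unique]
    congr 1
    · refine (tree_congr _ _ (graftInlIso F s G _ (fun a => ?_) fun c => ?_)).symm
      · exact inl_notMem_branchSet_inr F s b a
      · exact fun h => h (inr_mem_branchSet_inr F s hG hb c)
    · refine (tree_congr _ _ (graftInrIso F s G _ (fun a => ?_) fun c => ?_)).symm
      · exact inl_notMem_branchSet_inr F s b a
      · exact inr_mem_branchSet_inr F s hG hb c
  · rw [if_neg hs]
    have : IsEmpty {_u : Unit // F.parent s = none} := ⟨fun u => hs u.2⟩
    exact Fintype.sum_empty _

/-- The vertices `s` split into those of the trunk and those of the branch, and `G` stays on the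
side of `s`. -/
theorem sum_cut_graft [Fintype V] [Finite W] (F : PForest D V) (hF : F.IsTree)
    (G : PForest D W) (hG : G.IsTree) (J : {J // F.IsFirstPart J}) :
    ∑ s : V, tree K ((F.graft s G).trunk (partInl F s G J.1))
            ((hF.graft s G).trunk (isFirstPart_partInl F s G J.2)) ⊗ₜ[K]
          tree K ((F.graft s G).branch (partInl F s G J.1)) (.branch _) =
      bullet K D (tree K (F.trunk J.1) (hF.trunk J.2)) (tree K G hG) ⊗ₜ[K]
          tree K (F.branch J.1) (.branch J.1) +
        tree K (F.trunk J.1) (hF.trunk J.2) ⊗ₜ[K]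
          bullet K D (tree K (F.branch J.1) (.branch J.1)) (tree K G hG) := by
  classical
  rw [← Fintype.sum_subtype_add_sum_subtype (fun s => s ∈ F.branchSet J.1), add_comm,
    bullet_tree, bullet_tree, TensorProduct.sum_tmul, TensorProduct.tmul_sum]
  congr 1
  · refine Fintype.sum_congr _ _ fun s => ?_
    congr 1
    · exact (tree_congr _ _ (restrictGraftIso F s.1 G _ s.2 _
        (fun a => not_congr (inl_mem_branchSet F s.1 G J.1 a))
        fun b => (not_congr (inr_mem_branchSet F s.1 G J.1 b)).2 s.2)).symm
    · exact (tree_congr _ _ (restrictInlIso F s.1 G _ _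
        (fun a => inl_mem_branchSet F s.1 G J.1 a)
        fun b => (not_congr (inr_mem_branchSet F s.1 G J.1 b)).2 s.2)).symm
  · refine Fintype.sum_congr _ _ fun s => ?_
    congr 1
    · exact (tree_congr _ _ (restrictInlIso F s.1 G _ _
        (fun a => not_congr (inl_mem_branchSet F s.1 G J.1 a))
        fun b => not_not_intro ((inr_mem_branchSet F s.1 G J.1 b).2 s.2))).symm
    · exact (tree_congr _ _ (restrictGraftIso F s.1 G _ s.2 _
        (fun a => inl_mem_branchSet F s.1 G J.1 a)
        fun b => (inr_mem_branchSet F s.1 G J.1 b).2 s.2)).symm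

variable (K D)

theorem delta_bullet [CharZero K] (x y : GPT K D) :
    delta K D (bullet K D x y) =
      x ⊗ₜ[K] y + PreLieRigidity.act (bullet K D) y (delta K D x) := by
  induction x using induction_tree with
  | zero => simp
  | add a b ha hb =>
    simp only [map_add, LinearMap.add_apply, ha, hb, TensorProduct.add_tmul]
    abel
  | smul c a ha =>
    simp only [map_smul, LinearMap.smul_apply, ha, smul_add, TensorProduct.smul_tmul']
  | tree n F hF =>
  induction y using induction_tree with
  | zero => simp [PreLieRigidity.act]
  | add a b ha hb =>
    simp only [PreLieRigidity.act, map_add, LinearMap.add_apply, TensorProduct.tmul_add,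
      LinearMap.rTensor_add, LinearMap.lTensor_add] at ha hb ⊢
    rw [ha, hb]
    abel
  | smul c a ha =>
    simp only [PreLieRigidity.act, map_smul, LinearMap.add_apply, LinearMap.smul_apply,
      TensorProduct.tmul_smul, LinearMap.rTensor_smul, LinearMap.lTensor_smul] at ha ⊢
    rw [ha, smul_add, smul_add]
  | tree p G hG =>
    classical
    change delta K D (bullet K D (tree K F hF) (tree K G hG)) =
      tree K F hF ⊗ₜ[K] tree K G hG +
        PreLieRigidity.act (bullet K D) (tree K G hG) (delta K D (tree K F hF))
    have := Fintype.ofFinite {J // F.IsFirstPart J}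
    rw [bullet_tree, map_sum]
    simp only [delta_tree_graft F hF _ G hG]
    rw [← Finset.smul_sum, Finset.sum_add_distrib, Finset.sum_comm, add_comm, smul_add]
    congr 1
    · have hk : (F.numRoots : K) ≠ 0 := Nat.cast_ne_zero.2 (numRoots_ne_zero hF)
      rw [← Finset.sum_filter, Finset.sum_const, ← Fintype.card_subtype, ← Nat.card_eq_fintype_card,
        ← Nat.cast_smul_eq_nsmul K]
      exact inv_smul_smul₀ hk _
    · simp only [sum_cut_graft F hF G hG]
      rw [delta_tree, map_smul, map_sum]
      rfl

theorem delta_perm (x : GPT K D) :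
    (delta K D).rTensor (GPT K D) (delta K D x) =
      TensorProduct.rightComm K (GPT K D) (GPT K D) (GPT K D)
        ((delta K D).rTensor (GPT K D) (delta K D x)) := by
  induction x using induction_tree with
  | zero => simp
  | add a b ha hb => simp only [map_add, ← ha, ← hb]
  | smul c a ha => simp only [map_smul, ← ha]
  | tree n F hF =>
    classical
    change (delta K D).rTensor (GPT K D) (delta K D (tree K F hF)) =
      TensorProduct.rightComm K (GPT K D) (GPT K D) (GPT K D)
        ((delta K D).rTensor (GPT K D) (delta K D (tree K F hF)))
    have := Fintype.ofFinite {J // F.IsFirstPart J}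
    -- The iterated coproduct is a sum over ordered pairs of distinct first parts. The remaining
    -- trunk depends only on the union of the two branches, so exchanging the parts exchanges the
    -- last two factors.
    have key : (delta K D).rTensor (GPT K D) (delta K D (tree K F hF)) =
        (F.numRoots : K)⁻¹ • (F.numRoots : K)⁻¹ • ∑ J : {J // F.IsFirstPart J},
          ∑ I : {J // F.IsFirstPart J}, if I ≠ J then
            (tree K (F.restrict (F.branchSet J.1 ∪ F.branchSet I.1)ᶜ) (hF.trunk₂ J.2 I.2) ⊗ₜ[K]
              tree K (F.branch I.1) (.branch I.1)) ⊗ₜ[K] tree K (F.branch J.1) (.branch J.1)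
          else 0 := by
      rw [delta_tree, map_smul, map_sum, Finset.smul_sum (N := (GPT K D ⊗[K] GPT K D) ⊗[K] GPT K D)
        (r := (F.numRoots : K)⁻¹)
        (f := fun J => ∑ I : {J // F.IsFirstPart J}, if I ≠ J then _ else 0)]
      refine congrArg (_ • ·) (Finset.sum_congr rfl fun J _ => ?_)
      have := Fintype.ofFinite {I // (F.trunk J.1).IsFirstPart I}
      rw [LinearMap.rTensor_tmul, delta_tree, numRoots_trunk F J.2, ← TensorProduct.smul_tmul',
        TensorProduct.sum_tmul, ← Finset.sum_filter, Finset.sum_subtype (p := fun I => I ≠ J) _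
          (by simp), ← (trunkFirstParts J.2).sum_comp]
      refine congrArg (_ • ·) (Finset.sum_congr rfl fun I _ => ?_)
      have h1 := (trunkFirstParts J.2 I).1.2
      have h2 : partVal F J.1 I.1 ≠ J.1 := fun h => (trunkFirstParts J.2 I).2 (Subtype.ext h)
      rw [tree_congr _ (hF.trunk₂ J.2 h1) (trunkTrunkIso F J.1 I.1),
        tree_congr _ (.branch _) (trunkBranchIso J.2 I.1 h1 h2)]
      rfl
    rw [key]
    simp only [map_smul, map_sum]
    congr 2
    rw [Finset.sum_comm]
    refine Finset.sum_congr rfl fun J _ => Finset.sum_congr rfl fun I _ => ?_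
    by_cases h : I = J
    · simp [h]
    · rw [if_pos h, if_pos (Ne.symm h), TensorProduct.rightComm_tmul]
      refine congrArg₂ _ (congrArg₂ _ (tree_congr _ _ ?_) rfl) rfl
      exact (Iso.refl F).restrict _ _ fun x => by rw [Set.union_comm]; rfl

/-- The span of the partitioned trees with at most `n` vertices. -/
def filt (n : ℕ) : Submodule K (GPT K D) :=
  Submodule.span K {x | ∃ (m : ℕ) (F : PForest D (Fin m)) (hF : F.IsTree),
    m ≤ n ∧ tree K F hF = x}

variable {K D}

theorem tree_mem_filt [Finite V] (F : PForest D V) (hF : F.IsTree) {n : ℕ}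
    (h : Nat.card V ≤ n) : tree K F hF ∈ filt K D n :=
  Submodule.subset_span ⟨_, F.map (Finite.equivFin V), (F.mapIso _).isTree hF, h,
    tree_congr _ _ (F.mapIso _).symm⟩

/-- A single omitted vertex suffices to drop one level: a trunk misses the cut part, a branch misses
the roots. -/
theorem tree_restrict_mem_filt {n : ℕ} (F : PForest D (Fin n)) {S : Set (Fin n)}
    (hF : (F.restrict S).IsTree) {x : Fin n} (hx : x ∉ S) {m : ℕ} (h : n ≤ m + 1) :
    tree K (F.restrict S) hF ∈ filt K D m := by
  refine tree_mem_filt _ hF ?_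
  have h1 : S.ncard < Nat.card (Fin n) := Set.ncard_lt_card fun h => hx (h ▸ trivial)
  rw [Nat.card_fin] at h1
  rw [Nat.card_coe_set_eq]
  omega

variable (K D)

theorem isConnectedFiltration :
    PreLieRigidity.IsConnectedFiltration (delta K D) (filt K D) where
  zero := by
    rw [filt, Submodule.span_eq_bot]
    rintro _ ⟨m, F, hF, hm, rfl⟩
    obtain ⟨x⟩ := hF.nonempty
    exact absurd x.2 (by omega)
  succ n x hx := by
    have : filt K D (n + 1) ≤ (Submodule.map₂ (TensorProduct.mk K _ _) (filt K D n)
        (filt K D n)).comap (delta K D) := by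
      rw [filt, Submodule.span_le]
      rintro _ ⟨m, F, hF, hm, rfl⟩
      have := Fintype.ofFinite {J // F.IsFirstPart J}
      rw [SetLike.mem_coe, Submodule.mem_comap, delta_tree]
      refine Submodule.smul_mem _ _ (Submodule.sum_mem _ fun J _ => ?_)
      obtain ⟨J, hJ⟩ := J
      obtain ⟨x, r, rfl, hx, hr⟩ := id hJ
      refine Submodule.apply_mem_map₂ _ (tree_restrict_mem_filt F _ (x := x) ?_ hm)
        (tree_restrict_mem_filt F _ (F.notMem_branchSet_of_root hJ hr) hm)
      exact fun h => h ((F.mem_branchSet_step _ x).2 (.inl rfl))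
    exact this hx
  exhaust x := by
    have hm : Monotone (filt K D) := fun a b h => Submodule.span_mono (by
      rintro _ ⟨m, F, hF, hm, rfl⟩
      exact ⟨m, F, hF, hm.trans h, rfl⟩)
    have : x ∈ ⨆ n, filt K D n := by
      induction x using induction_tree with
      | zero => exact zero_mem _
      | add a b ha hb => exact add_mem ha hb
      | smul c a ha => exact Submodule.smul_mem _ c ha
      | tree n F hF =>
        exact Submodule.mem_iSup_of_mem n (tree_mem_filt F hF (Nat.card_fin n).le)
    exact (Submodule.mem_iSup_of_directed _ hm.directed_le).1 this

theorem isBialgebra [CharZero K] :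
    PreLieRigidity.IsBialgebra (bullet K D) (delta K D) where
  preLie := bullet_preLie K D
  perm := delta_perm K D
  compat := delta_bullet K D

end GPT

end

theorem mainTheorem10 (K : Type v) [Field K] [CharZero K] (D : Type u) :
    IsComPreLie (GPT.bullet K D) (GPT.shuffle K D) ∧
    (∀ x : GPT K D,
      (GPT.delta K D).rTensor (GPT K D) (GPT.delta K D x) =
        TensorProduct.rightComm K (GPT K D) (GPT K D) (GPT K D)
          ((GPT.delta K D).rTensor (GPT K D) (GPT.delta K D x))) ∧
    (∀ x y : GPT K D,
      GPT.delta K D (GPT.bullet K D x y) =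
        x ⊗ₜ[K] y +
          (((GPT.bullet K D).flip y).rTensor (GPT K D) (GPT.delta K D x) +
            ((GPT.bullet K D).flip y).lTensor (GPT K D) (GPT.delta K D x))) ∧
    (∀ (A : Type w) [RightPreLieRing A] [RightPreLieAlgebra K A]
      (f : LinearMap.ker (GPT.delta K D) →ₗ[K] A),
      ∃! φ : GPT K D →ₗ[K] A,
        (∀ x y : GPT K D, φ (GPT.bullet K D x y) = φ x * φ y) ∧
          ∀ x : LinearMap.ker (GPT.delta K D), φ x = f x) := by
  refine ⟨GPT.isComPreLie K D, GPT.delta_perm K D, GPT.delta_bullet K D, ?_⟩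
  intro A _ _ f
  exact PreLieRigidity.existsUnique_hom (GPT.isBialgebra K D) (GPT.isConnectedFiltration K D)
    (LinearMap.mul K A) (fun x y z => RightPreLieRing.assoc_symm' x y z) f
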